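/- Let $\alpha\in(0,1/2)$, $\beta\in(0,1)$, $\mu\in[0,1)$ and $\nu\in(0,1)$. Then there are constants $\hat\gamma>0$ and $\hat\eta\in\left(0,\frac{3-\sqrt5}{2}\right)$, depending only on $\alpha,\beta,\mu,\nu$, such that the following holds for all integers $1\le n<N$, every strictly convex $f_h:\mathbb R^N\to\mathbb R$ that is self-concordant with constant $2$ (that is, $f_h$ is $C^3$, convex, and $|\varphi'''(t)|\le 2\varphi''(t)^{3/2}$ for every restriction $\varphi(t)=f_h(x+tu)$ to a line) and has a minimizer $x^*$, and every starting point $x_0\in\mathbb R^N$. Let $S_0,S_1,\dots$ be independent random $n$-element subsets of $\{1,\dots,N\}$, each uniformly distributed. Let $P_k\in\mathbb R^{N\times n}$ consist of the columns of the identity matrix with index in $S_k$ (naive Nyström sampling), and let $R_k=P_k^T$. Write $$\lambda(x)=\left(\nabla f_h(x)^T[\nabla^2 f_h(x)]^{-1}\nabla f_h(x)\right)^{1/2},\qquad \hat\lambda_k(x)=\left((R_k\nabla f_h(x))^T[R_k\nabla^2 f_h(x)P_k]^{-1}R_k\nabla f_h(x)\right)^{1/2}.$$ The iterates are $x_{k+1}=x_k+t_kd_k$,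 where $$d_k=\begin{cases}-P_k[R_k\nabla^2f_h(x_k)P_k]^{-1}R_k\nabla f_h(x_k) & \text{if } \hat\lambda_k(x_k)>\mu\lambda(x_k)\text{ and }\hat\lambda_k(x_k)>\nu \quad(\text{coarse step}),\\ -[\nabla^2 f_h(x_k)]^{-1}\nabla f_h(x_k) & \text{otherwise}\quad(\text{Newton step}),\end{cases}$$ and $t_k$ is the first of the numbers $1,\beta,\beta^2,\dots$ with $f_h(x_k+t_kd_k)\le f_h(x_k)+\alpha t_k\nabla f_h(x_k)^Td_k$. The iteration is not stopped. (For $\mu=0$ only $\hat\lambda_k(x_k)>\nu$ is checked. If, moreover, $\hat\lambda_k(x_k)>\nu$ whenever $x_k\ne x^*$, then only coarse steps are taken before the minimizer is reached.) Then all $f_h(x_k)$ and $\lambda(x_k)$ are integrable, and for every $k$: 1. almost surely, if $\lambda(x_k)>\hat\eta$ then $\mathbb E[f_h(x_{k+1})-f_h(x_k)\mid x_k]\le-\hat\gamma$; and if $\lambda(x_k)>\hat\eta$ holds almost surely, then $\mathbb E[f_h(x_{k+1})-f_h(x_k)]\le-\hat\gamma$; 2. almost surely, if $\lambda(x_k)\le\hat\eta$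 and $x_k\neq x^*$ then $\mathbb E[\lambda(x_{k+1})\mid x_k]<\lambda(x_k)$; and if $\lambda(x_k)\le\hat\eta$ holds almost surely and $x_k$ is not almost surely equal to $x^*$, then $\mathbb E[\lambda(x_{k+1})]<\mathbb E[\lambda(x_k)]$. Moreover $\lim_{k\to\infty}\mathbb E[f_h(x_k)]=f_h(x^*)$, and $f_h(x_k)\to f_h(x^*)$ in probability and almost surely. The rate is super-linear almost surely: there is a deterministic sequence $R(k)\downarrow0$ such that, almost surely, $\lambda(x_{k+1})\le R(k)\lambda(x_k)$ for all $k$; and also $\mathbb E[\lambda(x_{k+1})]\le R(k)\,\mathbb E[\lambda(x_k)]$ for all $k$. -/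

import Mathlib

open MeasureTheory ProbabilityTheory Filter Topology Matrix
open scoped ENNReal

noncomputable section

namespace SIGMA

/-- `ℝ^N` with its Euclidean structure. -/
abbrev Vec (N : ℕ) : Type := EuclideanSpace ℝ (Fin N)

/-- A (thrice continuously differentiable) convex function on `ℝ^N` is self-concordant with
constant `M` if every restriction `φ(t) = f (x + t u)` to a line satisfies
`|φ'''(t)| ≤ M φ''(t)^{3/2}`. -/
structure IsSelfConcordant {N : ℕ} (M : ℝ) (f : Vec N → ℝ) : Prop where
  contDiff : ContDiff ℝ 3 f
  convex : ConvexOn ℝ Set.univ f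
  bound : ∀ (x u : Vec N) (t : ℝ),
    |iteratedDeriv 3 (fun s : ℝ => f (x + s • u)) t|
      ≤ M * (iteratedDeriv 2 (fun s : ℝ => f (x + s • u)) t) ^ (3 / 2 : ℝ)

/-- The gradient, as a column of coordinates. -/
def grad {N : ℕ} (f : Vec N → ℝ) (x : Vec N) : Fin N → ℝ :=
  (gradient f x).ofLp

/-- The Hessian matrix of second partial derivatives. -/
def hess {N : ℕ} (f : Vec N → ℝ) (x : Vec N) : Matrix (Fin N) (Fin N) ℝ :=
  Matrix.of fun i j =>
    fderiv ℝ (fderiv ℝ f) x (EuclideanSpace.single i 1) (EuclideanSpace.single j 1)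

/-- The Newton decrement `λ(x) = (∇f(x)ᵀ [∇²f(x)]⁻¹ ∇f(x))^{1/2}`. -/
def newtonDecrement {N : ℕ} (f : Vec N → ℝ) (x : Vec N) : ℝ :=
  Real.sqrt (grad f x ⬝ᵥ ((hess f x)⁻¹ *ᵥ grad f x))

/-- The Newton (fine) direction `d = - [∇²f(x)]⁻¹ ∇f(x)`. -/
def newtonDir {N : ℕ} (f : Vec N → ℝ) (x : Vec N) : Fin N → ℝ :=
  -((hess f x)⁻¹ *ᵥ grad f x)

/-- An `n`-element subset of the `N` column indices. -/
def ColumnSample (N n : ℕ) : Type := {s : Finset (Fin N) // s.card = n}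

instance (N n : ℕ) : MeasurableSpace (ColumnSample N n) := ⊤

/-- The prolongation matrix of a sample: its `i`-th column is the `s_i`-th column of the identity
matrix, where `s_i` is the `i`-th element of the sample. -/
def prolongation {N n : ℕ} (s : ColumnSample N n) : Matrix (Fin N) (Fin n) ℝ :=
  (1 : Matrix (Fin N) (Fin N) ℝ).submatrix id (s.1.orderEmbOfFin s.2)

/-- The restriction matrix `R = Pᵀ`. -/
def restriction {N n : ℕ} (s : ColumnSample N n) : Matrix (Fin n) (Fin N) ℝ :=
  (prolongation s)ᵀ

/-- The reduced Hessian `Q_H(x) = R ∇²f(x) P` of the Galerkin model. -/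
def reducedHess {N n : ℕ} (f : Vec N → ℝ) (s : ColumnSample N n) (x : Vec N) :
    Matrix (Fin n) (Fin n) ℝ :=
  restriction s * hess f x * prolongation s

/-- The approximate decrement `λ̂(x) = ((R∇f(x))ᵀ [Q_H(x)]⁻¹ R∇f(x))^{1/2}`. -/
def approxDecrement {N n : ℕ} (f : Vec N → ℝ) (s : ColumnSample N n) (x : Vec N) : ℝ :=
  Real.sqrt ((restriction s *ᵥ grad f x) ⬝ᵥ
    ((reducedHess f s x)⁻¹ *ᵥ (restriction s *ᵥ grad f x)))

/-- The coarse direction `d̂ = - P [Q_H(x)]⁻¹ R ∇f(x)`. -/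
def coarseDir {N n : ℕ} (f : Vec N → ℝ) (s : ColumnSample N n) (x : Vec N) : Fin N → ℝ :=
  -(prolongation s *ᵥ ((reducedHess f s x)⁻¹ *ᵥ (restriction s *ᵥ grad f x)))

/-- The search direction: coarse if `λ̂ > μ λ` and `λ̂ > ν`, and the Newton direction otherwise. -/
def direction {N n : ℕ} (f : Vec N → ℝ) (μ ν : ℝ) (s : ColumnSample N n) (x : Vec N) :
    Fin N → ℝ :=
  if μ * newtonDecrement f x < approxDecrement f s x ∧ ν < approxDecrement f s x then
    coarseDir f s x
  else newtonDir f x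

/-- The Armijo condition for the step size `t` along `d` at `x`. -/
def Armijo {N : ℕ} (f : Vec N → ℝ) (α : ℝ) (x : Vec N) (d : Fin N → ℝ) (t : ℝ) : Prop :=
  f (x + t • WithLp.toLp 2 d) ≤ f x + α * t * (grad f x ⬝ᵥ d)

/-- Backtracking: the first of the step sizes `1, β, β², …` that satisfies the Armijo condition. -/
def stepSize {N : ℕ} (f : Vec N → ℝ) (α β : ℝ) (x : Vec N) (d : Fin N → ℝ) : ℝ :=
  β ^ sInf {j : ℕ | Armijo f α x d (β ^ j)}

/-- One iteration of SIGMA with the sample `s`. -/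
def sigmaStep {N n : ℕ} (f : Vec N → ℝ) (α β μ ν : ℝ) (s : ColumnSample N n) (x : Vec N) :
    Vec N :=
  x + stepSize f α β x (direction f μ ν s x) • WithLp.toLp 2 (direction f μ ν s x)

/-- The iterates of SIGMA started at `x₀`; iteration `k` uses the sample `S k`. -/
def iterates {N n : ℕ} (f : Vec N → ℝ) (α β μ ν : ℝ) (S : ℕ → ColumnSample N n) (x₀ : Vec N) :
    ℕ → Vec N
  | 0 => x₀
  | k + 1 => sigmaStep f α β μ ν (S k) (iterates f α β μ ν S x₀ k)

/-- At each iteration `n` of the `N` columns are drawn uniformly without replacement,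
independently of the other iterations. -/
structure IsUniformSampling {Ω : Type*} [MeasurableSpace Ω] (Pr : Measure Ω) {N n : ℕ}
    (S : ℕ → Ω → ColumnSample N n) : Prop where
  measurable : ∀ k, Measurable (S k)
  uniform : ∀ k (s : ColumnSample N n), Pr (S k ⁻¹' {s}) = (N.choose n : ℝ≥0∞)⁻¹
  indep : iIndepFun S Pr

end SIGMA

end

namespace SIGMA

/-! ### One-dimensional estimates -/

/-! Every estimate holds on each trajectory, with constants that do not depend on the samples. Take
`η = min (ν, 1/2 - α, 1/64)` and `γ = αβη²/(1+η)`.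

If `λ > η`, the chosen direction has local norm at least `η`: a coarse step is taken only when `λ̂ >
ν ≥ η`, and a Newton step has local norm `λ`. Both directions satisfy `∇fᵀd = -dᵀ∇²f d`, so
self-concordance bounds the backtracked step from below and `f` drops by at least `γ`
(`apply_sigmaStep_le_sub`).

If `λ ≤ η`, then `λ̂ ≤ λ ≤ ν` rules out the coarse step, the full Newton step passes the Armijo test
(`sigmaStep_eq`), and `λ⁺ ≤ 32λ² ≤ λ/2`. So the second phase is never left. Since `f` is bounded
below by its minimum, the first phase ends within a number of steps common to all samples
(`exists_forall_newtonDecrement_le`).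

Self-concordance enters through one fact: along a line, the inverse square root of the second
derivative is 1-Lipschitz. Polarization adds a bound on mixed third derivatives, which yields the
quadratic estimate for the Newton step.

Randomness is harmless: there are finitely many samples, so each iterate is a simple function. This
gives integrability, and it bounds the ratios `λ(x_{k+1})/λ(x_k)` of the first phase; a geometric
sequence `R(k) = D·2⁻ᵏ` then serves both phases. -/

theorem nonneg_of_hasDerivAt_nonneg {F F' : ℝ → ℝ} {T : ℝ}
    (hF : ∀ t ∈ Set.Icc 0 T, HasDerivAt F (F' t) t) (hF' : ∀ t ∈ Set.Icc 0 T, 0 ≤ F' t)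
    (h0 : 0 ≤ F 0) : ∀ t ∈ Set.Icc 0 T, 0 ≤ F t := by
  intro t ht
  have hmono : MonotoneOn F (Set.Icc 0 T) := by
    refine monotoneOn_of_deriv_nonneg (convex_Icc 0 T)
      (fun s hs => (hF s hs).continuousAt.continuousWithinAt)
      (fun s hs => (hF s (interior_subset hs)).differentiableAt.differentiableWithinAt)
      fun s hs => ?_
    rw [(hF s (interior_subset hs)).deriv]
    exact hF' s (interior_subset hs)
  exact h0.trans (hmono ⟨le_rfl, ht.1.trans ht.2⟩ ht ht.1)

theorem nonneg_of_second_deriv_nonneg {F F' F'' : ℝ → ℝ} {T : ℝ}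
    (hF : ∀ t ∈ Set.Icc 0 T, HasDerivAt F (F' t) t)
    (hF' : ∀ t ∈ Set.Icc 0 T, HasDerivAt F' (F'' t) t)
    (hF'' : ∀ t ∈ Set.Icc 0 T, 0 ≤ F'' t) (h0 : 0 ≤ F 0) (h0' : 0 ≤ F' 0) :
    ∀ t ∈ Set.Icc 0 T, 0 ≤ F t :=
  nonneg_of_hasDerivAt_nonneg hF (nonneg_of_hasDerivAt_nonneg hF' hF'' h0') h0

/-- The derivative of `p^{-1/2}` is `-p'/(2p^{3/2})`, which the hypothesis bounds by 1. -/
theorem abs_inv_sqrt_sub_le {p p' : ℝ → ℝ} (hp : ∀ t, HasDerivAt p (p' t) t) (hpos : ∀ t, 0 < p t)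
    (hb : ∀ t, |p' t| ≤ 2 * p t * √(p t)) {t : ℝ} (ht : 0 ≤ t) :
    |(√(p t))⁻¹ - (√(p 0))⁻¹| ≤ t := by
  have hd : ∀ s ∈ Set.univ, HasDerivWithinAt (fun s => (√(p s))⁻¹)
      (-(p' s / (2 * √(p s))) / (√(p s)) ^ 2) Set.univ s := fun s _ =>
    (((hp s).sqrt (hpos s).ne').inv (Real.sqrt_pos.2 (hpos s)).ne').hasDerivWithinAt
  have hbd : ∀ s ∈ Set.univ, ‖-(p' s / (2 * √(p s))) / (√(p s)) ^ 2‖ ≤ 1 := by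
    intro s _
    have h1 := Real.sqrt_pos.2 (hpos s)
    rw [Real.sq_sqrt (hpos s).le, Real.norm_eq_abs, abs_div, abs_neg, abs_div, abs_of_pos (hpos s),
      abs_of_pos (by positivity : 0 < 2 * √(p s)), div_div, div_le_one (by have := hpos s; positivity)]
    calc _ ≤ _ := hb s
      _ = _ := by ring
  have := convex_univ.norm_image_sub_le_of_norm_hasDerivWithin_le hd hbd
    (Set.mem_univ 0) (Set.mem_univ t)
  simpa [abs_of_nonneg ht] using this

theorem sqrt_mul_one_sub_le {p p' : ℝ → ℝ} (hp : ∀ t, HasDerivAt p (p' t) t) (hpos : ∀ t, 0 < p t)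
    (hb : ∀ t, |p' t| ≤ 2 * p t * √(p t)) {t : ℝ} (ht : 0 ≤ t) :
    √(p t) * (1 - √(p 0) * t) ≤ √(p 0) := by
  have h := (abs_le.1 (abs_inv_sqrt_sub_le hp hpos hb ht)).1
  have h0 := Real.sqrt_pos.2 (hpos 0)
  have h1 := Real.sqrt_pos.2 (hpos t)
  have := mul_le_mul_of_nonneg_left h (mul_pos h0 h1).le
  have e : √(p 0) * √(p t) * ((√(p t))⁻¹ - (√(p 0))⁻¹) = √(p 0) - √(p t) := by field_simp
  rw [e] at this
  nlinarith

theorem le_sqrt_mul_one_add {p p' : ℝ → ℝ} (hp : ∀ t, HasDerivAt p (p' t) t) (hpos : ∀ t, 0 < p t)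
    (hb : ∀ t, |p' t| ≤ 2 * p t * √(p t)) {t : ℝ} (ht : 0 ≤ t) :
    √(p 0) ≤ √(p t) * (1 + √(p 0) * t) := by
  have h := (abs_le.1 (abs_inv_sqrt_sub_le hp hpos hb ht)).2
  have h0 := Real.sqrt_pos.2 (hpos 0)
  have h1 := Real.sqrt_pos.2 (hpos t)
  have := mul_le_mul_of_nonneg_left h (mul_pos h0 h1).le
  have e : √(p 0) * √(p t) * ((√(p t))⁻¹ - (√(p 0))⁻¹) = √(p 0) - √(p t) := by field_simp
  rw [e] at this
  nlinarith

/-- The sharp bound `p ≤ r²/(1-rt)²` is weakened to `r²/(1-rt)³`, whose double integral is rational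
and involves no logarithm. The lower bound that follows uses the same device. -/
theorem le_quadratic_of_selfConcordant {φ φ' p p' : ℝ → ℝ} (hφ : ∀ t, HasDerivAt φ (φ' t) t)
    (hφ' : ∀ t, HasDerivAt φ' (p t) t) (hp : ∀ t, HasDerivAt p (p' t) t) (hpos : ∀ t, 0 < p t)
    (hb : ∀ t, |p' t| ≤ 2 * p t * √(p t)) {T : ℝ} (hT : 0 ≤ T) (hT1 : √(p 0) * T < 1) :
    φ T ≤ φ 0 + φ' 0 * T + (√(p 0) * T) ^ 2 / (2 * (1 - √(p 0) * T)) := by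
  set r := √(p 0) with hr
  have hr0 : 0 < r := Real.sqrt_pos.2 (hpos 0)
  have hlt : ∀ t ∈ Set.Icc 0 T, 0 < 1 - r * t := fun t ht => by
    have := mul_le_mul_of_nonneg_left ht.2 hr0.le
    linarith
  have hlin : ∀ t, HasDerivAt (fun s => 1 - r * s) (-r) t := fun t => by
    simpa using ((hasDerivAt_id t).const_mul r).const_sub 1
  have key := nonneg_of_second_deriv_nonneg (T := T)
    (F := fun t => φ 0 + φ' 0 * t + ((1 - r * t)⁻¹ - 1 - r * t) / 2 - φ t)
    (F' := fun t => φ' 0 + (r * ((1 - r * t) ^ 2)⁻¹ - r) / 2 - φ' t)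
    (F'' := fun t => r ^ 2 * ((1 - r * t) ^ 3)⁻¹ - p t)
    (fun t ht => by
      have h1 := ((hlin t).inv (hlt t ht).ne')
      have h2 := (((((h1.sub_const 1).sub ((hasDerivAt_id t).const_mul r)).div_const 2).const_add
        0).add (((hasDerivAt_id t).const_mul (φ' 0)).const_add (φ 0))).sub (hφ t)
      refine (h2.congr_deriv ?_).congr_of_eventuallyEq (Eventually.of_forall fun s => ?_)
      · have := hlt t ht
        simp [div_eq_mul_inv]
        ring
      · simp
        ring)
    (fun t ht => by
      have h1 := (((hlin t).pow 2).inv (pow_pos (hlt t ht) 2).ne')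
      have h2 := (((((h1.const_mul r).sub_const r).div_const 2).const_add (φ' 0))).sub (hφ' t)
      refine h2.congr_deriv ?_
      have := (hlt t ht).ne'
      simp only [Pi.pow_apply]
      field_simp
      ring)
    (fun t ht => by
      have h1 := sqrt_mul_one_sub_le hp hpos hb ht.1
      rw [← hr] at h1
      have h2 := hlt t ht
      have h3 : √(p t) ^ 2 = p t := Real.sq_sqrt (hpos t).le
      have h4 : (√(p t) * (1 - r * t)) ^ 2 ≤ r ^ 2 :=
        pow_le_pow_left₀ (by positivity) h1 2
      rw [sub_nonneg, ← div_eq_mul_inv, le_div_iff₀ (by positivity)]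
      rw [mul_pow, h3] at h4
      have h5 : 1 - r * t ≤ 1 := by have := mul_nonneg hr0.le ht.1; linarith
      calc p t * (1 - r * t) ^ 3 = (p t * (1 - r * t) ^ 2) * (1 - r * t) := by ring
        _ ≤ (p t * (1 - r * t) ^ 2) * 1 := by
            have := (hpos t).le
            gcongr
        _ ≤ r ^ 2 := by linarith)
    (by simp) (by simp) T ⟨hT, le_rfl⟩
  have h2 := hlt T ⟨hT, le_rfl⟩
  have e : ((1 - r * T)⁻¹ - 1 - r * T) / 2 = (r * T) ^ 2 / (2 * (1 - r * T)) := by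
    field_simp
    ring
  simp only [e] at key
  linarith

theorem quadratic_le_of_selfConcordant {φ φ' p p' : ℝ → ℝ} (hφ : ∀ t, HasDerivAt φ (φ' t) t)
    (hφ' : ∀ t, HasDerivAt φ' (p t) t) (hp : ∀ t, HasDerivAt p (p' t) t) (hpos : ∀ t, 0 < p t)
    (hb : ∀ t, |p' t| ≤ 2 * p t * √(p t)) {T : ℝ} (hT : 0 ≤ T) :
    φ 0 + φ' 0 * T + (√(p 0) * T) ^ 2 / (2 * (1 + √(p 0) * T)) ≤ φ T := by
  set r := √(p 0) with hr
  have hr0 : 0 < r := Real.sqrt_pos.2 (hpos 0)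
  have hlt : ∀ t ∈ Set.Icc 0 T, 0 < 1 + r * t := fun t ht => by
    have := mul_nonneg hr0.le ht.1
    linarith
  have hlin : ∀ t, HasDerivAt (fun s => 1 + r * s) r t := fun t => by
    simpa using ((hasDerivAt_id t).const_mul r).const_add 1
  have key := nonneg_of_second_deriv_nonneg (T := T)
    (F := fun t => φ t - (φ 0 + φ' 0 * t + ((1 + r * t)⁻¹ - 1 + r * t) / 2))
    (F' := fun t => φ' t - (φ' 0 + (r - r * ((1 + r * t) ^ 2)⁻¹) / 2))
    (F'' := fun t => p t - r ^ 2 * ((1 + r * t) ^ 3)⁻¹)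
    (fun t ht => by
      have h1 := ((hlin t).inv (hlt t ht).ne')
      have h2 := (hφ t).sub (((((h1.sub_const 1).add
        ((hasDerivAt_id t).const_mul r)).div_const 2).const_add
        0).add (((hasDerivAt_id t).const_mul (φ' 0)).const_add (φ 0)))
      refine (h2.congr_deriv ?_).congr_of_eventuallyEq (Eventually.of_forall fun s => ?_)
      · have := hlt t ht
        simp [div_eq_mul_inv]
        ring
      · simp
        ring)
    (fun t ht => by
      have h1 := (((hlin t).pow 2).inv (pow_pos (hlt t ht) 2).ne')
      have h2 := (hφ' t).sub (((((h1.const_mul r).const_sub r).div_const 2).const_add (φ' 0)))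
      refine h2.congr_deriv ?_
      have := (hlt t ht).ne'
      simp only [Pi.pow_apply]
      field_simp
      ring)
    (fun t ht => by
      have h1 := le_sqrt_mul_one_add hp hpos hb ht.1
      rw [← hr] at h1
      have h2 := hlt t ht
      have h3 : √(p t) ^ 2 = p t := Real.sq_sqrt (hpos t).le
      have h4 : r ^ 2 ≤ (√(p t) * (1 + r * t)) ^ 2 :=
        pow_le_pow_left₀ (by positivity) h1 2
      rw [sub_nonneg, ← div_eq_mul_inv, div_le_iff₀ (by positivity)]
      rw [mul_pow, h3] at h4
      have h5 : 1 ≤ 1 + r * t := by have := mul_nonneg hr0.le ht.1; linarith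
      calc r ^ 2 ≤ (p t * (1 + r * t) ^ 2) * 1 := by linarith
        _ ≤ (p t * (1 + r * t) ^ 2) * (1 + r * t) := by
            have := (hpos t).le
            gcongr
        _ = p t * (1 + r * t) ^ 3 := by ring)
    (by simp) (by simp) T ⟨hT, le_rfl⟩
  have h2 := hlt T ⟨hT, le_rfl⟩
  have e : ((1 + r * T)⁻¹ - 1 + r * T) / 2 = (r * T) ^ 2 / (2 * (1 + r * T)) := by
    field_simp
    ring
  simp only [e] at key
  linarith

/-- A Grönwall type comparison of `q 1` and `q t`, `t ≤ 1`. -/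
theorem le_exp_mul_of_abs_deriv_le {q q' : ℝ → ℝ} {L : ℝ}
    (hq : ∀ t ∈ Set.Icc (0 : ℝ) 1, HasDerivAt q (q' t) t)
    (hb : ∀ t ∈ Set.Icc (0 : ℝ) 1, |q' t| ≤ L * q t) {t : ℝ} (ht : t ∈ Set.Icc (0 : ℝ) 1) :
    q t * Real.exp (L * t) ≤ q 1 * Real.exp L := by
  have hmono : MonotoneOn (fun s => q s * Real.exp (L * s)) (Set.Icc 0 1) := by
    have hd : ∀ s ∈ Set.Icc (0 : ℝ) 1, HasDerivAt (fun s => q s * Real.exp (L * s))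
        ((q' s + L * q s) * Real.exp (L * s)) s := fun s hs => by
      refine ((hq s hs).mul (((hasDerivAt_id s).const_mul L).exp)).congr_deriv ?_
      simp
      ring
    refine monotoneOn_of_deriv_nonneg (convex_Icc 0 1)
      (fun s hs => (hd s hs).continuousAt.continuousWithinAt)
      (fun s hs => (hd s (interior_subset hs)).differentiableAt.differentiableWithinAt)
      fun s hs => ?_
    rw [(hd s (interior_subset hs)).deriv]
    have := (abs_le.1 (hb s (interior_subset hs))).1
    exact mul_nonneg (by linarith) (Real.exp_pos _).le
  simpa using hmono ht (Set.right_mem_Icc.2 zero_le_one) ht.2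

theorem abs_le_of_abs_second_deriv_le {g g' g'' : ℝ → ℝ} {K : ℝ}
    (hg : ∀ t ∈ Set.Icc (0 : ℝ) 1, HasDerivAt g (g' t) t)
    (hg' : ∀ t ∈ Set.Icc (0 : ℝ) 1, HasDerivAt g' (g'' t) t)
    (hK : ∀ t ∈ Set.Icc (0 : ℝ) 1, |g'' t| ≤ K) : |g 1 - (g 0 + g' 0)| ≤ K := by
  have h1 : ∀ t ∈ Set.Icc (0 : ℝ) 1, ‖g' t - g' 0‖ ≤ K := fun t ht => by
    have h := (convex_Icc (0 : ℝ) 1).norm_image_sub_le_of_norm_hasDerivWithin_le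
      (fun s hs => (hg' s hs).hasDerivWithinAt) hK (Set.left_mem_Icc.2 zero_le_one) ht
    have hK0 : 0 ≤ K := (abs_nonneg _).trans (hK t ht)
    refine h.trans ?_
    rw [sub_zero, Real.norm_of_nonneg ht.1]
    exact mul_le_of_le_one_right hK0 ht.2
  have h := (convex_Icc (0 : ℝ) 1).norm_image_sub_le_of_norm_hasDerivWithin_le
    (f := fun t => g t - t * g' 0) (f' := fun t => g' t - g' 0)
    (fun s hs => ((hg s hs).sub (by simpa using (hasDerivAt_id s).mul_const (g' 0))).hasDerivWithinAt)
    h1 (Set.left_mem_Icc.2 zero_le_one) (Set.right_mem_Icc.2 zero_le_one)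
  simp only [Real.norm_eq_abs] at h
  norm_num at h
  convert h using 2
  ring

/-! ### Self-concordant functions with nondegenerate second derivative -/

section NormedSpace

variable {E : Type*} [NormedAddCommGroup E] [NormedSpace ℝ E]

theorem hasDerivAt_line {F : Type*} [NormedAddCommGroup F] [NormedSpace ℝ F] {h : E → F}
    (hh : Differentiable ℝ h) (x u : E) (t : ℝ) :
    HasDerivAt (fun s : ℝ => h (x + s • u)) (fderiv ℝ h (x + t • u) u) t := by
  have h1 : HasDerivAt (fun s : ℝ => x + s • u) u t := by
    simpa using ((hasDerivAt_id t).smul_const u).const_add x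
  exact (hh (x + t • u)).hasFDerivAt.comp_hasDerivAt t h1

/-- The second derivative as a nested Fréchet derivative. -/
noncomputable abbrev snd (f : E → ℝ) (x : E) : E →L[ℝ] E →L[ℝ] ℝ := fderiv ℝ (fderiv ℝ f) x

/-- The third derivative as a nested Fréchet derivative. -/
noncomputable abbrev trd (f : E → ℝ) (x : E) : E →L[ℝ] E →L[ℝ] E →L[ℝ] ℝ := fderiv ℝ (fderiv ℝ (fderiv ℝ f)) x

/-- Self-concordance with constant `2` and nondegenerate second derivative, in terms of Fréchet
derivatives. -/
structure IsNondegenerateSelfConcordant (f : E → ℝ) : Prop where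
  contDiff : ContDiff ℝ 3 f
  pos : ∀ x u, u ≠ 0 → 0 < snd f x u u
  bound : ∀ x u, |trd f x u u u| ≤ 2 * snd f x u u * √(snd f x u u)

theorem _root_.ContDiff.differentiable_fderiv_fderiv {f : E → ℝ} (hf : ContDiff ℝ 3 f) :
    Differentiable ℝ f ∧ Differentiable ℝ (fderiv ℝ f) ∧
      Differentiable ℝ (fderiv ℝ (fderiv ℝ f)) := by
  have h1 : ContDiff ℝ 2 (fderiv ℝ f) := hf.fderiv_right (by norm_num)
  have h2 : ContDiff ℝ 1 (fderiv ℝ (fderiv ℝ f)) := h1.fderiv_right (by norm_num)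
  exact ⟨hf.differentiable (by norm_num), h1.differentiable (by norm_num),
    h2.differentiable (by norm_num)⟩

theorem hasDerivAt_fderiv_line {f : E → ℝ} (hf : ContDiff ℝ 3 f) (x u w : E) (t : ℝ) :
    HasDerivAt (fun s : ℝ => fderiv ℝ f (x + s • u) w) (snd f (x + t • u) u w) t := by
  simpa using (hasDerivAt_line hf.differentiable_fderiv_fderiv.2.1 x u t).clm_apply
    (hasDerivAt_const t w)

theorem hasDerivAt_snd_line {f : E → ℝ} (hf : ContDiff ℝ 3 f) (x u v w : E) (t : ℝ) :
    HasDerivAt (fun s : ℝ => snd f (x + s • u) v w) (trd f (x + t • u) u v w) t := by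
  have h1 := hasDerivAt_line (F := E →L[ℝ] E →L[ℝ] ℝ) (h := snd f)
    hf.differentiable_fderiv_fderiv.2.2 x u t
  exact (ContinuousLinearMap.apply ℝ ℝ w ∘L
    ContinuousLinearMap.apply ℝ (E →L[ℝ] ℝ) v).hasFDerivAt.comp_hasDerivAt t h1

theorem snd_comm {f : E → ℝ} (hf : ContDiff ℝ 3 f) (x u v : E) : snd f x u v = snd f x v u :=
  (hf.contDiffAt (x := x).isSymmSndFDerivAt (by norm_num)).eq u v

theorem trd_comm_left {f : E → ℝ} (hf : ContDiff ℝ 3 f) (x u v w : E) :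
    trd f x u v w = trd f x v u w := by
  have h1 : ContDiff ℝ 2 (fderiv ℝ f) := hf.fderiv_right (by norm_num)
  rw [(h1.contDiffAt.isSymmSndFDerivAt (by norm_num)).eq u v]

/-- Symmetry of the second derivative, differentiated along a line. -/
theorem trd_comm_right {f : E → ℝ} (hf : ContDiff ℝ 3 f) (x u v w : E) :
    trd f x u v w = trd f x u w v := by
  have h1 := hasDerivAt_snd_line hf x u v w 0
  have h2 := hasDerivAt_snd_line hf x u w v 0
  simp only [zero_smul, add_zero] at h1 h2
  refine h1.unique (h2.congr_of_eventuallyEq (Eventually.of_forall fun s => ?_))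
  exact snd_comm hf _ _ _

namespace IsNondegenerateSelfConcordant

variable {f : E → ℝ}

theorem nonneg (hf : IsNondegenerateSelfConcordant f) (x u : E) : 0 ≤ snd f x u u := by
  rcases eq_or_ne u 0 with rfl | hu
  · simp
  · exact (hf.pos x u hu).le

/-- Polarization: with `T` the cubic form and `q` the quadratic one, `T(d+w) - T(d-w) = 6T(d,d,w) +
2T(w,w,w)`. Since `q(d+w) + q(d-w) = 4` with both terms nonnegative, each is at most 4, so `|T(d±w)|
≤ 4q(d±w)`. Hence `6|T(d,d,w)| ≤ 16 + 4`, which is enough for the constant 4. -/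
theorem abs_trd_le_of_eq_one (hf : IsNondegenerateSelfConcordant f) {x d w : E}
    (hd : snd f x d d = 1) (hw : snd f x w w = 1) : |trd f x d d w| ≤ 4 := by
  have hb : ∀ u, snd f x u u ≤ 4 → |trd f x u u u| ≤ 4 * snd f x u u := fun u hu => by
    refine (hf.bound x u).trans ?_
    have h1 : √(snd f x u u) ≤ 2 := Real.sqrt_le_iff.2 ⟨by norm_num, by linarith⟩
    have := mul_le_mul_of_nonneg_left h1 (hf.nonneg x u)
    linarith
  have h2 := snd_comm hf.contDiff x w d
  have ep : snd f x (d + w) (d + w) = 2 + 2 * snd f x d w := by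
    simp only [map_add, _root_.add_apply, hd, hw, h2]; ring
  have em : snd f x (d - w) (d - w) = 2 - 2 * snd f x d w := by
    simp only [map_sub, _root_.sub_apply, hd, hw, h2]; ring
  have np := hf.nonneg x (d + w)
  have nm := hf.nonneg x (d - w)
  have bp := abs_le.1 (hb (d + w) (by linarith))
  have bm := abs_le.1 (hb (d - w) (by linarith))
  have bw := hf.bound x w
  rw [hw, Real.sqrt_one, mul_one, mul_one] at bw
  have bw := abs_le.1 bw
  have t1 : trd f x d w d = trd f x d d w := trd_comm_right hf.contDiff x d w d
  have t2 : trd f x w d d = trd f x d d w := by rw [trd_comm_left hf.contDiff, t1]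
  have t3 : trd f x w d w = trd f x d w w := trd_comm_left hf.contDiff x w d w
  have t4 : trd f x w w d = trd f x d w w := by rw [trd_comm_right hf.contDiff, t3]
  have tp : trd f x (d + w) (d + w) (d + w)
      = trd f x d d d + 3 * trd f x d d w + 3 * trd f x d w w + trd f x w w w := by
    simp only [map_add, _root_.add_apply, t1, t2, t3, t4]; ring
  have tm : trd f x (d - w) (d - w) (d - w)
      = trd f x d d d - 3 * trd f x d d w + 3 * trd f x d w w - trd f x w w w := by
    simp only [map_sub, _root_.sub_apply, t1, t2, t3, t4]; ring
  rw [tp, ep] at bp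
  rw [tm, em] at bm
  exact abs_le.2 ⟨by linarith [bp.1, bp.2, bm.1, bm.2, bw.1, bw.2],
    by linarith [bp.1, bp.2, bm.1, bm.2, bw.1, bw.2]⟩

theorem abs_trd_le (hf : IsNondegenerateSelfConcordant f) (x d w : E) :
    |trd f x d d w| ≤ 4 * snd f x d d * √(snd f x w w) := by
  rcases eq_or_ne d 0 with rfl | hd
  · simp
  rcases eq_or_ne w 0 with rfl | hw
  · simp
  have hd' := Real.sqrt_pos.2 (hf.pos x d hd)
  have hw' := Real.sqrt_pos.2 (hf.pos x w hw)
  have sd := Real.mul_self_sqrt (hf.nonneg x d)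
  have sw := Real.mul_self_sqrt (hf.nonneg x w)
  set a := √(snd f x d d)
  set b := √(snd f x w w)
  have h := hf.abs_trd_le_of_eq_one (x := x) (d := a⁻¹ • d) (w := b⁻¹ • w)
    (by simp [← sd]; field_simp) (by simp [← sw]; field_simp)
  simp only [map_smul, _root_.smul_apply, smul_eq_mul] at h
  rw [abs_mul, abs_mul, abs_mul, abs_of_pos (inv_pos.2 hd'), abs_of_pos (inv_pos.2 hw')] at h
  rw [← sd]
  calc |trd f x d d w| = (a * a * b) * (b⁻¹ * (a⁻¹ * (a⁻¹ * |trd f x d d w|))) := by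
        field_simp
    _ ≤ (a * a * b) * 4 := by gcongr
    _ = _ := by ring

theorem abs_trd_le' (hf : IsNondegenerateSelfConcordant f) (x d w : E) :
    |trd f x d w w| ≤ 4 * √(snd f x d d) * snd f x w w := by
  rw [trd_comm_left hf.contDiff, trd_comm_right hf.contDiff]
  exact (hf.abs_trd_le x w d).trans_eq (by ring)

theorem line_le (hf : IsNondegenerateSelfConcordant f) (x u : E) {t : ℝ} (ht : 0 ≤ t)
    (ht1 : √(snd f x u u) * t < 1) :
    f (x + t • u) ≤ f x + fderiv ℝ f x u * t
      + (√(snd f x u u) * t) ^ 2 / (2 * (1 - √(snd f x u u) * t)) := by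
  rcases eq_or_ne u 0 with rfl | hu
  · simp
  have := le_quadratic_of_selfConcordant
    (hasDerivAt_line hf.contDiff.differentiable_fderiv_fderiv.1 x u)
    (hasDerivAt_fderiv_line hf.contDiff x u u) (hasDerivAt_snd_line hf.contDiff x u u u)
    (fun s => hf.pos _ u hu) (fun s => hf.bound _ u) ht (by simpa using ht1)
  simpa using this

theorem le_add (hf : IsNondegenerateSelfConcordant f) (x u : E) :
    f x + fderiv ℝ f x u + √(snd f x u u) ^ 2 / (2 * (1 + √(snd f x u u))) ≤ f (x + u) := by
  rcases eq_or_ne u 0 with rfl | hu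
  · simp
  have := quadratic_le_of_selfConcordant
    (hasDerivAt_line hf.contDiff.differentiable_fderiv_fderiv.1 x u)
    (hasDerivAt_fderiv_line hf.contDiff x u u) (hasDerivAt_snd_line hf.contDiff x u u u)
    (fun s => hf.pos _ u hu) (fun s => hf.bound _ u) zero_le_one
  simpa using this

theorem sqrt_snd_line_le (hf : IsNondegenerateSelfConcordant f) (x u : E)
    (hu2 : √(snd f x u u) ≤ 1 / 2) {t : ℝ} (ht : t ∈ Set.Icc (0 : ℝ) 1) :
    √(snd f (x + t • u) u u) ≤ 2 * √(snd f x u u) := by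
  rcases eq_or_ne u 0 with rfl | hu
  · simp
  have h := sqrt_mul_one_sub_le (hasDerivAt_snd_line hf.contDiff x u u u)
    (fun s => hf.pos _ u hu) (fun s => hf.bound _ u) ht.1
  simp only [zero_smul, add_zero] at h
  have h0 := Real.sqrt_nonneg (snd f x u u)
  have h1 : √(snd f x u u) * t ≤ 1 / 2 :=
    (mul_le_of_le_one_right h0 ht.2).trans hu2
  have h2 := Real.sqrt_nonneg (snd f (x + t • u) u u)
  nlinarith

/-- If `d` is a Newton step at `x` of small local norm, the gradient at `x + d` is quadratically
small in the dual local norm. -/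
theorem abs_fderiv_newton_le (hf : IsNondegenerateSelfConcordant f) {x d : E}
    (hd : ∀ w, snd f x d w = -fderiv ℝ f x w) (hr : √(snd f x d d) ≤ 1 / 64) (w : E) :
    |fderiv ℝ f (x + d) w| ≤ 32 * snd f x d d * √(snd f (x + d) w w) := by
  have hline := fun t ht => hf.sqrt_snd_line_le x d (hr.trans (by norm_num)) (t := t) ht
  set r := √(snd f x d d) with hrdef
  have hr0 : 0 ≤ r := Real.sqrt_nonneg _
  have hw : ∀ t ∈ Set.Icc (0 : ℝ) 1, √(snd f (x + t • d) w w) ≤ 2 * √(snd f (x + d) w w) := by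
    intro t ht
    -- Along the step the logarithmic derivative is at most `4·2r ≤ 1/8`, so `L = 1` suffices; then
    -- `e < 4` gives the factor 2 after the square root.
    have h := le_exp_mul_of_abs_deriv_le (L := 1)
      (fun s _ => hasDerivAt_snd_line hf.contDiff x d w w s)
      (fun s hs => by
        refine (hf.abs_trd_le' _ d w).trans ?_
        have := hline s hs
        exact mul_le_mul_of_nonneg_right (by linarith) (hf.nonneg _ w)) ht
    have h1 : snd f (x + t • d) w w ≤ snd f (x + t • d) w w * Real.exp (1 * t) :=
      le_mul_of_one_le_right (hf.nonneg _ w) (Real.one_le_exp (by linarith [ht.1]))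
    rw [one_smul] at h
    have h2 : snd f (x + d) w w * Real.exp 1 ≤ snd f (x + d) w w * 4 :=
      mul_le_mul_of_nonneg_left (by linarith [Real.exp_one_lt_d9]) (hf.nonneg _ w)
    refine Real.sqrt_le_iff.2 ⟨by positivity, ?_⟩
    rw [mul_pow, Real.sq_sqrt (hf.nonneg _ w)]
    linarith
  have hK : ∀ t ∈ Set.Icc (0 : ℝ) 1,
      |trd f (x + t • d) d d w| ≤ 32 * snd f x d d * √(snd f (x + d) w w) := by
    intro t ht
    refine (hf.abs_trd_le _ d w).trans ?_
    have h1 : snd f (x + t • d) d d ≤ 4 * snd f x d d := by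
      have := pow_le_pow_left₀ (Real.sqrt_nonneg _) (hline t ht) 2
      rw [mul_pow, hrdef, Real.sq_sqrt (hf.nonneg _ d), Real.sq_sqrt (hf.nonneg _ d)] at this
      linarith
    calc 4 * snd f (x + t • d) d d * √(snd f (x + t • d) w w)
        ≤ 4 * (4 * snd f x d d) * (2 * √(snd f (x + d) w w)) := by
          have := hf.nonneg x d
          have := hw t ht
          gcongr
      _ = _ := by ring
  -- The Newton equation `hd` cancels the zeroth and first order Taylor terms of the gradient,
  -- leaving only the remainder.
  have := abs_le_of_abs_second_deriv_le
    (fun t _ => hasDerivAt_fderiv_line hf.contDiff x d w t)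
    (fun t _ => hasDerivAt_snd_line hf.contDiff x d d w t) hK
  simpa [hd w] using this

end IsNondegenerateSelfConcordant

end NormedSpace

/-- Cauchy–Schwarz for the Hessian form, by testing nonnegativity on `q(v)u - B(u,v)v`. -/
theorem IsNondegenerateSelfConcordant.abs_snd_le {E : Type*} [NormedAddCommGroup E]
    [NormedSpace ℝ E] {f : E → ℝ} (hf : IsNondegenerateSelfConcordant f) (x u v : E) :
    |snd f x u v| ≤ √(snd f x u u) * √(snd f x v v) := by
  rcases eq_or_ne v 0 with rfl | hv
  · simp
  have h := hf.nonneg x (snd f x v v • u - snd f x u v • v)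
  have hc := snd_comm hf.contDiff x v u
  simp only [map_sub, _root_.sub_apply, map_smul, _root_.smul_apply, smul_eq_mul, hc] at h
  have hp := hf.pos x v hv
  rw [← Real.sqrt_mul (hf.nonneg x u)]
  refine Real.abs_le_sqrt ?_
  refine le_of_mul_le_mul_left ?_ hp
  linarith

/-! ### From line restrictions to Fréchet derivatives -/

section Bridge

variable {E : Type*} [NormedAddCommGroup E] [NormedSpace ℝ E]

theorem iteratedDeriv_two_line {f : E → ℝ} (hf : ContDiff ℝ 3 f) (x u : E) :
    iteratedDeriv 2 (fun s : ℝ => f (x + s • u)) = fun t => snd f (x + t • u) u u := by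
  have h1 : deriv (fun s : ℝ => f (x + s • u)) = fun t => fderiv ℝ f (x + t • u) u :=
    funext fun t => (hasDerivAt_line hf.differentiable_fderiv_fderiv.1 x u t).deriv
  rw [iteratedDeriv_succ, iteratedDeriv_one, h1]
  exact funext fun t => (hasDerivAt_fderiv_line hf x u u t).deriv

theorem iteratedDeriv_three_line {f : E → ℝ} (hf : ContDiff ℝ 3 f) (x u : E) :
    iteratedDeriv 3 (fun s : ℝ => f (x + s • u)) = fun t => trd f (x + t • u) u u u := by
  rw [iteratedDeriv_succ, iteratedDeriv_two_line hf]
  exact funext fun t => (hasDerivAt_snd_line hf x u u u t).deriv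

theorem snd_nonneg_of_convexOn {f : E → ℝ} (hf : ContDiff ℝ 3 f) (hc : ConvexOn ℝ Set.univ f)
    (x u : E) : 0 ≤ snd f x u u := by
  have hconv : ConvexOn ℝ Set.univ (fun s : ℝ => f (x + s • u)) := by
    have := hc.comp_affineMap (AffineMap.lineMap x (x + u) : ℝ →ᵃ[ℝ] E)
    simpa [Function.comp_def, AffineMap.lineMap_apply, add_comm] using this
  have hmono := hconv.monotoneOn_deriv fun t _ =>
    (hasDerivAt_line hf.differentiable_fderiv_fderiv.1 x u t).differentiableAt
  have h1 : deriv (fun s : ℝ => f (x + s • u)) = fun t => fderiv ℝ f (x + t • u) u :=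
    funext fun t => (hasDerivAt_line hf.differentiable_fderiv_fderiv.1 x u t).deriv
  rw [h1, monotoneOn_univ] at hmono
  have h := hmono.deriv_nonneg (x := 0)
  rw [(hasDerivAt_fderiv_line hf x u u 0).deriv] at h
  simpa using h

theorem rpow_three_halves {a : ℝ} (ha : 0 ≤ a) : a ^ (3 / 2 : ℝ) = a * √a := by
  rw [show (3 / 2 : ℝ) = 1 + 1 / 2 by norm_num, Real.rpow_add_of_nonneg ha (by norm_num)
    (by norm_num), Real.rpow_one, Real.sqrt_eq_rpow]

/-- If a second derivative vanishes at a point then, by self-concordance, it vanishes along the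
line. -/
theorem eqOn_zero_of_selfConcordant {p p' : ℝ → ℝ} (hp : ∀ t, HasDerivAt p (p' t) t)
    (hpos : ∀ t, 0 ≤ p t) (hb : ∀ t, |p' t| ≤ 2 * p t * √(p t)) (h0 : p 0 = 0) :
    ∀ t ∈ Set.Icc (0 : ℝ) 1, p t = 0 := by
  have hcont : ContinuousOn p (Set.Icc 0 1) := fun t _ => (hp t).continuousAt.continuousWithinAt
  obtain ⟨C, hC⟩ := isCompact_Icc.exists_bound_of_continuousOn hcont
  -- Bounding `√p` by `√C` on the compact interval makes the differential inequality linear, so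
  -- Grönwall uniqueness applies.
  refine eq_zero_of_abs_deriv_le_mul_abs_self_of_eq_zero_right (K := 2 * √C) hcont
    (fun t _ => (hp t).hasDerivWithinAt) h0 fun t ht => ?_
  have h1 := hC t (Set.Ico_subset_Icc_self ht)
  rw [Real.norm_eq_abs, abs_of_nonneg (hpos t)] at h1
  rw [Real.norm_eq_abs, Real.norm_eq_abs, abs_of_nonneg (hpos t)]
  have h2 := mul_le_mul_of_nonneg_left (Real.sqrt_le_sqrt h1) (hpos t)
  have := hb t
  linarith

end Bridge

variable {N n : ℕ}

/-- A second derivative vanishing at `x` in direction `u` would vanish along the segment to `x + u`;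
then `f` would be affine there, against strict convexity. -/
theorem IsSelfConcordant.nondegenerate {f : Vec N → ℝ} (hf : IsSelfConcordant 2 f)
    (hs : StrictConvexOn ℝ Set.univ f) : IsNondegenerateSelfConcordant f := by
  have hnn := snd_nonneg_of_convexOn hf.contDiff hf.convex
  have hb : ∀ x u, |trd f x u u u| ≤ 2 * snd f x u u * √(snd f x u u) := fun x u => by
    have := hf.bound x u 0
    rw [iteratedDeriv_two_line hf.contDiff, iteratedDeriv_three_line hf.contDiff] at this
    simp only [zero_smul, add_zero] at this
    rwa [rpow_three_halves (hnn x u), ← mul_assoc] at this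
  refine ⟨hf.contDiff, fun x u hu => ?_, hb⟩
  refine lt_of_le_of_ne (hnn x u) fun h0 => ?_
  have hz := eqOn_zero_of_selfConcordant (hasDerivAt_snd_line hf.contDiff x u u u)
    (fun t => hnn _ u) (fun t => hb _ u) (by simpa using h0.symm)
  have hlin : ∀ t ∈ Set.Icc (0 : ℝ) 1, f (x + t • u) = f x + t * fderiv ℝ f x u := by
    -- The signs `σ = 1` and `σ = -1` give the two inequalities.
    have key : ∀ σ : ℝ, ∀ t ∈ Set.Icc (0 : ℝ) 1,
        0 ≤ σ * (f (x + t • u) - (f x + t * fderiv ℝ f x u)) := fun σ =>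
      nonneg_of_second_deriv_nonneg
        (F' := fun t => σ * (fderiv ℝ f (x + t • u) u - fderiv ℝ f x u))
        (F'' := fun t => σ * snd f (x + t • u) u u)
        (fun t _ => ((hasDerivAt_line hf.contDiff.differentiable_fderiv_fderiv.1 x u t).sub
          (by simpa using ((hasDerivAt_id t).mul_const (fderiv ℝ f x u)).const_add (f x))).const_mul
            σ)
        (fun t _ => ((hasDerivAt_fderiv_line hf.contDiff x u u t).sub_const _).const_mul σ)
        (fun t ht => by simp [hz t ht]) (by simp) (by simp)
    intro t ht
    have h1 := key 1 t ht
    have h2 := key (-1) t ht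
    linarith
  have hne : x ≠ x + u := by simpa using hu
  have h := hs.2 (Set.mem_univ x) (Set.mem_univ (x + u)) hne
    (by norm_num : (0 : ℝ) < 1 / 2) (by norm_num : (0 : ℝ) < 1 / 2) (by norm_num)
  have e : (1 / 2 : ℝ) • x + (1 / 2 : ℝ) • (x + u) = x + (1 / 2 : ℝ) • u := by module
  have h1 := hlin 1 (by norm_num)
  rw [one_smul] at h1
  rw [e, hlin (1 / 2) (by norm_num), h1] at h
  simp only [smul_eq_mul] at h
  linarith

/-! ### Matrix form -/

theorem toLp_eq_sum (v : Fin N → ℝ) :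
    (WithLp.toLp 2 v : Vec N) = ∑ i, v i • EuclideanSpace.single i (1 : ℝ) := by
  ext j
  simp [Pi.single_apply]

theorem dotProduct_hess_mulVec (f : Vec N → ℝ) (x : Vec N) (v w : Fin N → ℝ) :
    v ⬝ᵥ (hess f x *ᵥ w) = snd f x (WithLp.toLp 2 v) (WithLp.toLp 2 w) := by
  rw [toLp_eq_sum v, toLp_eq_sum w]
  simp only [dotProduct, mulVec, hess, Matrix.of_apply, map_sum, map_smul,
    _root_.sum_apply, _root_.smul_apply, smul_eq_mul, Finset.mul_sum]
  rw [Finset.sum_comm]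
  refine Finset.sum_congr rfl fun i _ => Finset.sum_congr rfl fun j _ => by ring

theorem grad_dotProduct (f : Vec N → ℝ) (x : Vec N) (v : Fin N → ℝ) :
    grad f x ⬝ᵥ v = fderiv ℝ f x (WithLp.toLp 2 v) := by
  have h : inner ℝ (gradient f x) (WithLp.toLp 2 v : Vec N) = fderiv ℝ f x (WithLp.toLp 2 v) := by
    rw [gradient, InnerProductSpace.toDual_symm_apply]
  rw [← h, EuclideanSpace.inner_eq_star_dotProduct]
  simp [grad, dotProduct_comm]

theorem newtonDecrement_nonneg (f : Vec N → ℝ) (x : Vec N) : 0 ≤ newtonDecrement f x :=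
  Real.sqrt_nonneg _

theorem prolongation_mulVec_injective (s : ColumnSample N n) :
    Function.Injective (prolongation s).mulVec := by
  intro v w h
  ext i
  have := congrFun h (s.1.orderEmbOfFin s.2 i)
  simpa [prolongation, mulVec, dotProduct, Matrix.one_apply] using this

namespace IsNondegenerateSelfConcordant

variable {f : Vec N → ℝ}

theorem posDef_hess (hf : IsNondegenerateSelfConcordant f) (x : Vec N) : (hess f x).PosDef := by
  refine PosDef.of_dotProduct_mulVec_pos ?_ fun v hv => ?_
  · ext i j
    simp only [hess, conjTranspose_apply, Matrix.of_apply, star_trivial]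
    exact snd_comm hf.contDiff x _ _
  · rw [star_trivial, dotProduct_hess_mulVec]
    exact hf.pos x _ (by simpa using hv)

theorem posDef_reducedHess (hf : IsNondegenerateSelfConcordant f) (s : ColumnSample N n)
    (x : Vec N) : (reducedHess f s x).PosDef := by
  have := (hf.posDef_hess x).conjTranspose_mul_mul_same (prolongation_mulVec_injective s)
  rwa [conjTranspose_eq_transpose_of_trivial] at this

theorem snd_newtonDir (hf : IsNondegenerateSelfConcordant f) (x w : Vec N) :
    snd f x (WithLp.toLp 2 (newtonDir f x)) w = -fderiv ℝ f x w := by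
  have hdet := (Matrix.isUnit_iff_isUnit_det _).1 (hf.posDef_hess x).isUnit
  have h : hess f x *ᵥ newtonDir f x = -grad f x := by
    rw [newtonDir, mulVec_neg, mulVec_mulVec, mul_nonsing_inv _ hdet, one_mulVec]
  have h1 := dotProduct_hess_mulVec f x w.ofLp (newtonDir f x)
  rw [h, dotProduct_neg, dotProduct_comm, grad_dotProduct, WithLp.toLp_ofLp] at h1
  rw [snd_comm hf.contDiff, ← h1]

theorem newtonDecrement_eq (hf : IsNondegenerateSelfConcordant f) (x : Vec N) :
    newtonDecrement f x
      = √(snd f x (WithLp.toLp 2 (newtonDir f x)) (WithLp.toLp 2 (newtonDir f x))) := by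
  rw [hf.snd_newtonDir, ← grad_dotProduct, newtonDir, dotProduct_neg, neg_neg, newtonDecrement]

/-- The reduced Newton equation, tested against its own solution. The line search needs only this
identity, which the Newton direction shares. -/
theorem fderiv_coarseDir (hf : IsNondegenerateSelfConcordant f) (s : ColumnSample N n)
    (x : Vec N) : fderiv ℝ f x (WithLp.toLp 2 (coarseDir f s x))
      = -snd f x (WithLp.toLp 2 (coarseDir f s x)) (WithLp.toLp 2 (coarseDir f s x)) := by
  have hdet := (Matrix.isUnit_iff_isUnit_det _).1 (hf.posDef_reducedHess s x).isUnit
  rw [← dotProduct_hess_mulVec, ← grad_dotProduct]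
  set y := (reducedHess f s x)⁻¹ *ᵥ (restriction s *ᵥ grad f x) with hy
  have h : reducedHess f s x *ᵥ y = restriction s *ᵥ grad f x := by
    rw [hy, mulVec_mulVec, mul_nonsing_inv _ hdet, one_mulVec]
  have h1 : ∀ v, (prolongation s *ᵥ y) ⬝ᵥ v = y ⬝ᵥ (restriction s *ᵥ v) := fun v => by
    rw [restriction, dotProduct_mulVec y, vecMul_transpose]
  have h2 : restriction s *ᵥ hess f x *ᵥ prolongation s *ᵥ y = restriction s *ᵥ grad f x := by
    rw [← h, reducedHess, ← mulVec_mulVec, ← mulVec_mulVec]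
  rw [coarseDir, ← hy, mulVec_neg, dotProduct_neg, neg_dotProduct_neg, dotProduct_comm, h1, h1, h2]

theorem approxDecrement_eq (hf : IsNondegenerateSelfConcordant f) (s : ColumnSample N n)
    (x : Vec N) : approxDecrement f s x
      = √(snd f x (WithLp.toLp 2 (coarseDir f s x)) (WithLp.toLp 2 (coarseDir f s x))) := by
  rw [← neg_eq_iff_eq_neg.2 (hf.fderiv_coarseDir s x), ← grad_dotProduct, coarseDir,
    dotProduct_neg, neg_neg, approxDecrement, restriction, dotProduct_comm, dotProduct_comm (grad f x)]
  congr 1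
  rw [dotProduct_mulVec _ _ (grad f x), vecMul_transpose]

theorem abs_fderiv_le (hf : IsNondegenerateSelfConcordant f) (x w : Vec N) :
    |fderiv ℝ f x w| ≤ newtonDecrement f x * √(snd f x w w) := by
  have := hf.abs_snd_le x (WithLp.toLp 2 (newtonDir f x)) w
  rwa [hf.snd_newtonDir, abs_neg, ← hf.newtonDecrement_eq] at this

/-- The decrement is the dual local norm of the gradient, attained at the Newton direction: testing
there gives `λ² ≤ Cλ`. -/
theorem newtonDecrement_le_of_abs_fderiv_le (hf : IsNondegenerateSelfConcordant f) {x : Vec N}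
    {C : ℝ} (hC : 0 ≤ C) (h : ∀ w, |fderiv ℝ f x w| ≤ C * √(snd f x w w)) :
    newtonDecrement f x ≤ C := by
  have h1 := h (WithLp.toLp 2 (newtonDir f x))
  rw [← neg_eq_iff_eq_neg.2 (hf.snd_newtonDir x _), abs_neg, abs_of_nonneg (hf.nonneg _ _),
    ← hf.newtonDecrement_eq] at h1
  have h2 := Real.sq_sqrt (hf.nonneg x (WithLp.toLp 2 (newtonDir f x)))
  rw [← hf.newtonDecrement_eq] at h2
  rw [← h2, sq] at h1
  rcases (newtonDecrement_nonneg f x).eq_or_lt with h3 | h3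
  · rwa [← h3]
  · exact le_of_mul_le_mul_right h1 h3

/-- Testing the dual norm on the coarse direction gives `λ̂² ≤ λλ̂`. -/
theorem approxDecrement_le (hf : IsNondegenerateSelfConcordant f) (s : ColumnSample N n)
    (x : Vec N) : approxDecrement f s x ≤ newtonDecrement f x := by
  have h1 := hf.abs_fderiv_le x (WithLp.toLp 2 (coarseDir f s x))
  rw [hf.fderiv_coarseDir, abs_neg, abs_of_nonneg (hf.nonneg _ _), ← hf.approxDecrement_eq] at h1
  have h2 := Real.sq_sqrt (hf.nonneg x (WithLp.toLp 2 (coarseDir f s x)))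
  rw [← hf.approxDecrement_eq] at h2
  rw [← h2, sq] at h1
  have h0 : 0 ≤ approxDecrement f s x := Real.sqrt_nonneg _
  rcases h0.eq_or_lt with h3 | h3
  · rw [← h3]
    exact newtonDecrement_nonneg f x
  · exact le_of_mul_le_mul_right h1 h3

/-- Near the minimizer the optimality gap is bounded by the squared Newton decrement. -/
theorem sub_le_newtonDecrement_sq (hf : IsNondegenerateSelfConcordant f) {x : Vec N}
    (hx : newtonDecrement f x ≤ 1 / 4) (y : Vec N) : f x - f y ≤ newtonDecrement f x ^ 2 := by
  have h1 := hf.le_add x (y - x)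
  rw [add_sub_cancel] at h1
  have h2 := (abs_le.1 (hf.abs_fderiv_le x (y - x))).1
  have h0 := newtonDecrement_nonneg f x
  set l := newtonDecrement f x
  set r := √(snd f x (y - x) (y - x)) with hr
  have hr0 : 0 ≤ r := Real.sqrt_nonneg _
  have h3 : -l ^ 2 ≤ r ^ 2 / (2 * (1 + r)) - l * r := by
    -- For `r ≤ 1` the fraction is at least `r²/4` and a square is completed; for `r ≥ 1` it is at
    -- least `r/4 ≥ λr`.
    rcases le_total r 1 with h | h
    · have : r ^ 2 / 4 ≤ r ^ 2 / (2 * (1 + r)) := by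
        apply div_le_div_of_nonneg_left (by positivity) (by positivity) (by linarith)
      nlinarith [sq_nonneg (r / 2 - l)]
    · have : r / 4 ≤ r ^ 2 / (2 * (1 + r)) := by
        rw [div_le_div_iff₀ (by norm_num) (by positivity)]
        nlinarith
      nlinarith
  linarith

end IsNondegenerateSelfConcordant

/-! ### One iteration -/

namespace IsNondegenerateSelfConcordant

variable {f : Vec N → ℝ}

/-- The condition on `t` says `t ≤ 1 - δt`. The remainder is then at most `tδ²/2`, so at least half
of the predicted decrease `tδ²` survives. -/
theorem armijo_of_mul_le (hf : IsNondegenerateSelfConcordant f) {α : ℝ} (hα : α ≤ 1 / 2)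
    {x : Vec N} {d : Fin N → ℝ}
    (hd : fderiv ℝ f x (WithLp.toLp 2 d) = -snd f x (WithLp.toLp 2 d) (WithLp.toLp 2 d)) {t : ℝ}
    (ht0 : 0 ≤ t) (ht : t * (1 + √(snd f x (WithLp.toLp 2 d) (WithLp.toLp 2 d))) ≤ 1) :
    Armijo f α x d t := by
  have hsq := Real.sq_sqrt (hf.nonneg x (WithLp.toLp 2 d))
  have h := hf.line_le x (WithLp.toLp 2 d) ht0
  rw [Armijo, grad_dotProduct, hd]
  rw [hd] at h
  set δ := √(snd f x (WithLp.toLp 2 d) (WithLp.toLp 2 d))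
  rcases ht0.eq_or_lt with rfl | htpos
  · simp
  have hlt : 0 < 1 - δ * t := by linarith
  have h1 := h (by linarith)
  rw [← hsq] at h1 ⊢
  have h2 : (δ * t) ^ 2 / (2 * (1 - δ * t)) ≤ t * δ ^ 2 / 2 := by
    rw [div_le_div_iff₀ (by positivity) (by norm_num)]
    have : t * δ ^ 2 * t ≤ t * δ ^ 2 * (1 - δ * t) :=
      mul_le_mul_of_nonneg_left (by linarith) (by positivity)
    nlinarith
  have h3 : α * (t * δ ^ 2) ≤ 1 / 2 * (t * δ ^ 2) :=
    mul_le_mul_of_nonneg_right hα (by positivity)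
  nlinarith

theorem stepSize_spec (hf : IsNondegenerateSelfConcordant f) {α β : ℝ} (hα : α ≤ 1 / 2)
    (hβ : 0 < β ∧ β < 1) {x : Vec N} {d : Fin N → ℝ}
    (hd : fderiv ℝ f x (WithLp.toLp 2 d) = -snd f x (WithLp.toLp 2 d) (WithLp.toLp 2 d)) :
    Armijo f α x d (stepSize f α β x d) ∧
      β ≤ stepSize f α β x d * (1 + √(snd f x (WithLp.toLp 2 d) (WithLp.toLp 2 d))) := by
  have harm : ∀ {t : ℝ}, 0 ≤ t → _ → _ := fun {t} => hf.armijo_of_mul_le hα hd (t := t)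
  set δ := √(snd f x (WithLp.toLp 2 d) (WithLp.toLp 2 d)) with hδ
  have hδ0 : 0 ≤ δ := Real.sqrt_nonneg _
  -- Since `sInf ∅ = 0` on the naturals, the Armijo condition at the infimum requires nonemptiness.
  have hne : {j : ℕ | Armijo f α x d (β ^ j)}.Nonempty := by
    obtain ⟨j, hj⟩ := exists_pow_lt_of_lt_one (by positivity : 0 < 1 / (1 + δ)) hβ.2
    refine ⟨j, harm (pow_pos hβ.1 j).le ?_⟩
    rw [lt_div_iff₀ (by positivity)] at hj
    exact hj.le
  refine ⟨Nat.sInf_mem hne, ?_⟩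
  rw [stepSize]
  -- Either the unit step was accepted, or the preceding trial failed and hence exceeded `1/(1+δ)`.
  rcases Nat.eq_zero_or_pos (sInf {j : ℕ | Armijo f α x d (β ^ j)}) with h0 | h0
  · rw [h0, pow_zero]
    linarith [hβ.2]
  · obtain ⟨m, hm⟩ := Nat.exists_eq_succ_of_ne_zero h0.ne'
    have hnot : ¬ Armijo f α x d (β ^ m) := fun h => by
      have := Nat.sInf_le (s := {j : ℕ | Armijo f α x d (β ^ j)}) h
      omega
    have h1 : 1 < β ^ m * (1 + δ) := by
      by_contra hc
      exact hnot (harm (pow_pos hβ.1 m).le (not_lt.1 hc))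
    rw [hm, pow_succ]
    nlinarith [hβ.1]

theorem fderiv_direction (hf : IsNondegenerateSelfConcordant f) (μ ν : ℝ) (s : ColumnSample N n)
    (x : Vec N) : fderiv ℝ f x (WithLp.toLp 2 (direction f μ ν s x))
      = -snd f x (WithLp.toLp 2 (direction f μ ν s x)) (WithLp.toLp 2 (direction f μ ν s x)) := by
  rw [direction]
  split_ifs
  · exact hf.fderiv_coarseDir s x
  · rw [hf.snd_newtonDir, neg_neg]

theorem apply_sigmaStep_le (hf : IsNondegenerateSelfConcordant f) {α β : ℝ}
    (hα : 0 < α ∧ α < 1 / 2) (hβ : 0 < β ∧ β < 1) (μ ν : ℝ) (s : ColumnSample N n) (x : Vec N)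
    {δ : ℝ} (hδ : 0 ≤ δ) (hδd : δ ≤ √(snd f x (WithLp.toLp 2 (direction f μ ν s x))
      (WithLp.toLp 2 (direction f μ ν s x)))) :
    f (sigmaStep f α β μ ν s x) ≤ f x - α * β * δ ^ 2 / (1 + δ) := by
  have hd := hf.fderiv_direction μ ν s x
  obtain ⟨h1, h2⟩ := hf.stepSize_spec hα.2.le hβ hd
  rw [Armijo, grad_dotProduct, hd] at h1
  rw [sigmaStep]
  have hsq := Real.sq_sqrt (hf.nonneg x (WithLp.toLp 2 (direction f μ ν s x)))
  rw [← hsq] at h1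
  set t := stepSize f α β x (direction f μ ν s x)
  set r := √(snd f x (WithLp.toLp 2 (direction f μ ν s x)) (WithLp.toLp 2 (direction f μ ν s x)))
  refine h1.trans ?_
  have hr : 0 ≤ r := hδ.trans hδd
  have h3 : δ ^ 2 / (1 + δ) ≤ r ^ 2 / (1 + r) := by
    rw [div_le_div_iff₀ (by positivity) (by positivity)]
    nlinarith [mul_nonneg hδ hr, mul_nonneg (mul_nonneg hδ hr) (sub_nonneg.2 hδd),
      mul_nonneg (sub_nonneg.2 hδd) (add_nonneg hδ hr)]
  have h4 : β * (r ^ 2 / (1 + r)) ≤ t * r ^ 2 := by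
    rw [mul_div_assoc', div_le_iff₀ (by positivity)]
    nlinarith [mul_le_mul_of_nonneg_right h2 (sq_nonneg r)]
  have h5 : α * (β * (δ ^ 2 / (1 + δ))) ≤ α * (t * r ^ 2) :=
    mul_le_mul_of_nonneg_left ((mul_le_mul_of_nonneg_left h3 hβ.1.le).trans h4) hα.1.le
  have e : α * β * δ ^ 2 / (1 + δ) = α * (β * (δ ^ 2 / (1 + δ))) := by ring
  rw [e]
  linarith

theorem apply_sigmaStep_le_self (hf : IsNondegenerateSelfConcordant f) {α β : ℝ}
    (hα : 0 < α ∧ α < 1 / 2) (hβ : 0 < β ∧ β < 1) (μ ν : ℝ) (s : ColumnSample N n) (x : Vec N) :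
    f (sigmaStep f α β μ ν s x) ≤ f x := by
  simpa using hf.apply_sigmaStep_le hα hβ μ ν s x le_rfl (Real.sqrt_nonneg _)

/-- The first phase: a guaranteed decrease. -/
theorem apply_sigmaStep_le_sub (hf : IsNondegenerateSelfConcordant f) {α β : ℝ}
    (hα : 0 < α ∧ α < 1 / 2) (hβ : 0 < β ∧ β < 1) (μ : ℝ) {ν η : ℝ} (hη : 0 < η) (hην : η ≤ ν)
    (s : ColumnSample N n) {x : Vec N} (hx : η < newtonDecrement f x) :
    f (sigmaStep f α β μ ν s x) ≤ f x - α * β * η ^ 2 / (1 + η) := by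
  refine hf.apply_sigmaStep_le hα hβ μ ν s x hη.le ?_
  rw [direction]
  split_ifs with h
  · rw [← hf.approxDecrement_eq]
    exact hην.trans h.2.le
  · rw [← hf.newtonDecrement_eq]
    exact hx.le

/-- The second phase: a full Newton step is taken. -/
theorem sigmaStep_eq (hf : IsNondegenerateSelfConcordant f) {α : ℝ}
    (hα : 0 < α ∧ α < 1 / 2) (β μ : ℝ) {ν : ℝ}
    (s : ColumnSample N n) {x : Vec N} (hxν : newtonDecrement f x ≤ ν)
    (hxα : newtonDecrement f x ≤ 1 / 2 - α) :
    sigmaStep f α β μ ν s x = x + WithLp.toLp 2 (newtonDir f x) := by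
  have hdir : direction f μ ν s x = newtonDir f x := by
    rw [direction, if_neg]
    rintro ⟨-, h⟩
    exact absurd h (not_lt.2 ((hf.approxDecrement_le s x).trans hxν))
  have harm : Armijo f α x (newtonDir f x) 1 := by
    have h0 := newtonDecrement_nonneg f x
    have h := hf.line_le x (WithLp.toLp 2 (newtonDir f x)) zero_le_one
    rw [← hf.newtonDecrement_eq, mul_one] at h
    have h1 := h (by linarith [hα.1])
    rw [Armijo, grad_dotProduct]
    have hsq := Real.sq_sqrt (hf.nonneg x (WithLp.toLp 2 (newtonDir f x)))
    rw [← hf.newtonDecrement_eq, hf.snd_newtonDir] at hsq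
    have e : fderiv ℝ f x (WithLp.toLp 2 (newtonDir f x)) = -newtonDecrement f x ^ 2 := by linarith
    rw [e] at h1 ⊢
    set l := newtonDecrement f x
    have hα1 := hα.1
    have hα2 := hα.2
    -- With `l ≤ 1/2 - α`, `2(1-α)(1-l) ≥ (1-α)(1+2α) = 1 + α(1-2α) ≥ 1`.
    have h2 : l ^ 2 / (2 * (1 - l)) ≤ (1 - α) * l ^ 2 := by
      rw [div_le_iff₀ (by linarith)]
      have h3 : 1 ≤ (1 - α) * (2 * (1 - l)) := by nlinarith
      nlinarith [mul_le_mul_of_nonneg_left h3 (sq_nonneg l)]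
    linarith
  have hstep : stepSize f α β x (newtonDir f x) = 1 := by
    have h0 : sInf {j : ℕ | Armijo f α x (newtonDir f x) (β ^ j)} = 0 :=
      Nat.sInf_eq_zero.2 (Or.inl (by simpa using harm))
    rw [stepSize, h0, pow_zero]
  rw [sigmaStep, hdir, hstep, one_smul]

theorem newtonDecrement_sigmaStep_le (hf : IsNondegenerateSelfConcordant f) {α : ℝ}
    (hα : 0 < α ∧ α < 1 / 2) (β μ : ℝ) {ν : ℝ}
    (s : ColumnSample N n) {x : Vec N} (hxν : newtonDecrement f x ≤ ν)
    (hxα : newtonDecrement f x ≤ 1 / 2 - α) (hx : newtonDecrement f x ≤ 1 / 64) :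
    newtonDecrement f (sigmaStep f α β μ ν s x) ≤ 32 * newtonDecrement f x ^ 2 := by
  rw [hf.sigmaStep_eq hα β μ s hxν hxα]
  refine hf.newtonDecrement_le_of_abs_fderiv_le (by positivity) fun w => ?_
  have h := hf.abs_fderiv_newton_le (hf.snd_newtonDir x)
    (by rwa [← hf.newtonDecrement_eq]) w
  rwa [← Real.sq_sqrt (hf.nonneg x (WithLp.toLp 2 (newtonDir f x))), ← hf.newtonDecrement_eq] at h

theorem eq_of_newtonDecrement_eq_zero (hf : IsNondegenerateSelfConcordant f)
    (hs : StrictConvexOn ℝ Set.univ f) {x xstar : Vec N} (hstar : ∀ y, f xstar ≤ f y)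
    (hx : newtonDecrement f x = 0) : x = xstar := by
  have h := hf.sub_le_newtonDecrement_sq (x := x) (by rw [hx]; norm_num) xstar
  rw [hx] at h
  refine hs.eq_of_isMinOn (fun y _ => ?_) (fun y _ => hstar y) (Set.mem_univ _) (Set.mem_univ _)
  have := hstar y
  change f x ≤ f y
  linarith

/-- Makes the phase events `{λ ≤ η}` measurable with respect to the current iterate. -/
theorem continuous_newtonDecrement (hf : IsNondegenerateSelfConcordant f) :
    Continuous (newtonDecrement f) := by
  have h1 : ContDiff ℝ 2 (fderiv ℝ f) := hf.contDiff.fderiv_right (by norm_num)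
  have h2 : ContDiff ℝ 1 (fderiv ℝ (fderiv ℝ f)) := h1.fderiv_right (by norm_num)
  have hg : Continuous (grad f) := by
    have : Continuous (gradient f) :=
      (InnerProductSpace.toDual ℝ (Vec N)).symm.continuous.comp h1.continuous
    exact (PiLp.continuous_ofLp 2 _).comp this
  have hh : Continuous (hess f) := by
    refine continuous_matrix fun i j => ?_
    simp only [hess, Matrix.of_apply]
    exact (h2.continuous.clm_apply continuous_const).clm_apply continuous_const
  have hinv : Continuous fun x => (hess f x)⁻¹ := by
    simp only [Matrix.inv_def, Ring.inverse_eq_inv']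
    refine Continuous.smul (hh.matrix_det.inv₀ fun x => ?_) hh.matrix_adjugate
    exact ((Matrix.isUnit_iff_isUnit_det _).1 (hf.posDef_hess x).isUnit).ne_zero
  exact (hg.dotProduct (hinv.matrix_mulVec hg)).sqrt

end IsNondegenerateSelfConcordant

/-! ### Trajectories -/

section Trajectory

variable {f : Vec N → ℝ} {α β μ ν η : ℝ} {xstar : Vec N}

/-- The conditions on the threshold between the two phases. -/
structure IsThreshold (α ν η : ℝ) : Prop where
  pos : 0 < η
  le_nu : η ≤ ν
  le_alpha : η ≤ 1 / 2 - α
  le_one : η ≤ 1 / 64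

theorem IsNondegenerateSelfConcordant.newtonDecrement_sigmaStep_le_of_threshold
    (hf : IsNondegenerateSelfConcordant f) (hα : 0 < α ∧ α < 1 / 2) (β μ : ℝ)
    (hη : IsThreshold α ν η) (s : ColumnSample N n) {x : Vec N} (hx : newtonDecrement f x ≤ η) :
    newtonDecrement f (sigmaStep f α β μ ν s x) ≤ 32 * newtonDecrement f x ^ 2 :=
  hf.newtonDecrement_sigmaStep_le hα β μ s (hx.trans hη.le_nu) (hx.trans hη.le_alpha)
    (hx.trans hη.le_one)

theorem IsNondegenerateSelfConcordant.newtonDecrement_sigmaStep_le_half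
    (hf : IsNondegenerateSelfConcordant f) (hα : 0 < α ∧ α < 1 / 2) (β μ : ℝ)
    (hη : IsThreshold α ν η) (s : ColumnSample N n) {x : Vec N} (hx : newtonDecrement f x ≤ η) :
    newtonDecrement f (sigmaStep f α β μ ν s x) ≤ 1 / 2 * newtonDecrement f x := by
  have h := hf.newtonDecrement_sigmaStep_le_of_threshold hα β μ hη s hx
  have h0 := newtonDecrement_nonneg f x
  have := hη.le_one
  nlinarith

/-- The number of iterations of the first phase is bounded independently of the samples. -/
theorem exists_forall_newtonDecrement_le (hf : IsNondegenerateSelfConcordant f)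
    (hα : 0 < α ∧ α < 1 / 2) (hβ : 0 < β ∧ β < 1) (μ : ℝ) (hη : IsThreshold α ν η)
    (hstar : ∀ z, f xstar ≤ f z) (x₀ : Vec N) :
    ∃ K : ℕ, ∀ (s : ℕ → ColumnSample N n) (m : ℕ),
      newtonDecrement f (iterates f α β μ ν s x₀ (K + m)) ≤ η * (1 / 2) ^ m := by
  set γ := α * β * η ^ 2 / (1 + η) with hγ
  have hγ0 : 0 < γ := by
    have := hα.1; have := hβ.1; have := hη.pos
    positivity
  obtain ⟨K, hK⟩ := exists_nat_gt ((f x₀ - f xstar) / γ)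
  rw [div_lt_iff₀ hγ0] at hK
  refine ⟨K, fun s => ?_⟩
  have hstay : ∀ j, newtonDecrement f (iterates f α β μ ν s x₀ j) ≤ η →
      ∀ m, newtonDecrement f (iterates f α β μ ν s x₀ (j + m)) ≤ η * (1 / 2) ^ m := by
    intro j hj m
    induction m with
    | zero => simpa using hj
    | succ m ih =>
      have hle : newtonDecrement f (iterates f α β μ ν s x₀ (j + m)) ≤ η :=
        ih.trans (mul_le_of_le_one_right hη.pos.le (pow_le_one₀ (by norm_num) (by norm_num)))
      have h := hf.newtonDecrement_sigmaStep_le_half hα β μ hη (s (j + m)) hle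
      rw [← add_assoc, iterates, pow_succ]
      linarith
  -- `K` consecutive first-phase steps would push `f` below its minimum.
  obtain ⟨j, hjK, hj⟩ : ∃ j < K, newtonDecrement f (iterates f α β μ ν s x₀ j) ≤ η := by
    by_contra! hcon
    have hdec : ∀ j ≤ K, f (iterates f α β μ ν s x₀ j) ≤ f x₀ - j * γ := by
      intro j
      induction j with
      | zero => intro _; simp [iterates]
      | succ j ih =>
        intro hj
        have h := hf.apply_sigmaStep_le_sub hα hβ μ hη.pos hη.le_nu (s j) (hcon j (by omega))
        have := ih (by omega)
        rw [iterates]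
        push_cast
        linarith
    have h1 := hdec K le_rfl
    have h2 := hstar (iterates f α β μ ν s x₀ K)
    linarith
  intro m
  refine hstay K ?_ m
  obtain ⟨i, rfl⟩ := Nat.exists_eq_add_of_le hjK.le
  exact (hstay j hj i).trans
    (mul_le_of_le_one_right hη.pos.le (pow_le_one₀ (by norm_num) (by norm_num)))

theorem apply_iterates_le (hf : IsNondegenerateSelfConcordant f) (hα : 0 < α ∧ α < 1 / 2)
    (hβ : 0 < β ∧ β < 1) (μ ν : ℝ) (s : ℕ → ColumnSample N n) (x₀ : Vec N) (k : ℕ) :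
    f (iterates f α β μ ν s x₀ k) ≤ f x₀ := by
  induction k with
  | zero => exact le_rfl
  | succ k ih => exact (hf.apply_sigmaStep_le_self hα hβ μ ν _ _).trans ih

theorem tendsto_apply_iterates (hf : IsNondegenerateSelfConcordant f)
    (hα : 0 < α ∧ α < 1 / 2) (hβ : 0 < β ∧ β < 1) (μ : ℝ) (hη : IsThreshold α ν η)
    (hstar : ∀ z, f xstar ≤ f z) (x₀ : Vec N) (s : ℕ → ColumnSample N n) :
    Tendsto (fun k => f (iterates f α β μ ν s x₀ k)) atTop (𝓝 (f xstar)) := by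
  obtain ⟨K, hK⟩ := exists_forall_newtonDecrement_le (n := n) hf hα hβ μ hη hstar x₀
  rw [← tendsto_add_atTop_iff_nat K]
  have hlim : Tendsto (fun m : ℕ => f xstar + (η * (1 / 2) ^ m) ^ 2) atTop (𝓝 (f xstar)) := by
    have h := tendsto_pow_atTop_nhds_zero_of_lt_one (r := (1 / 2 : ℝ)) (by norm_num) (by norm_num)
    simpa using ((h.const_mul η).pow 2).const_add (f xstar)
  refine tendsto_of_tendsto_of_tendsto_of_le_of_le tendsto_const_nhds hlim
    (fun m => hstar _) fun m => ?_
  have hKm := hK s m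
  rw [add_comm K m] at hKm
  have hη4 : newtonDecrement f (iterates f α β μ ν s x₀ (m + K)) ≤ 1 / 4 := by
    have : η * (1 / 2) ^ m ≤ η :=
      mul_le_of_le_one_right hη.pos.le (pow_le_one₀ (by norm_num) (by norm_num))
    linarith [hη.le_one]
  have h1 := hf.sub_le_newtonDecrement_sq hη4 xstar
  have h2 := pow_le_pow_left₀ (newtonDecrement_nonneg _ _) hKm 2
  simp only
  linarith

theorem newtonDecrement_sigmaStep_eq_zero (hf : IsNondegenerateSelfConcordant f)
    (hα : 0 < α ∧ α < 1 / 2) (β μ : ℝ) (hη : IsThreshold α ν η) (s : ColumnSample N n) {x : Vec N}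
    (hx : newtonDecrement f x = 0) : newtonDecrement f (sigmaStep f α β μ ν s x) = 0 := by
  have h := hf.newtonDecrement_sigmaStep_le_half hα β μ hη s (hx.le.trans hη.pos.le)
  rw [hx, mul_zero] at h
  exact h.antisymm (newtonDecrement_nonneg _ _)

end Trajectory

/-! ### Random trajectories -/

/-- As `A` and `Y` are `m`-measurable, the indicator of `A` passes through the conditional
expectation and `Y` on `A` is its own. -/
theorem condExp_le_of_le_on {Ω : Type*} {m m0 : MeasurableSpace Ω} {P : Measure[m0] Ω} [IsFiniteMeasure P]
    (hm : m ≤ m0) {X Y : Ω → ℝ} (hX : Integrable X P) (hY : Integrable Y P)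
    (hYm : StronglyMeasurable[m] Y) {A : Set Ω} (hA : MeasurableSet[m] A)
    (h : ∀ ω ∈ A, X ω ≤ Y ω) : ∀ᵐ ω ∂P, ω ∈ A → (P[X | m]) ω ≤ Y ω := by
  have h1 := condExp_indicator (m := m) hX hA
  have h2 := condExp_mono (m := m) (hX.indicator (hm A hA)) (hY.indicator (hm A hA))
    (Eventually.of_forall fun ω => by
      by_cases hω : ω ∈ A
      · simpa [hω] using h ω hω
      · simp [hω])
  rw [condExp_of_stronglyMeasurable hm (hYm.indicator hA) (hY.indicator (hm A hA))] at h2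
  filter_upwards [h1, h2] with ω h1 h2 hω
  rw [h1] at h2
  simpa [hω] using h2

section Random

variable {Ω : Type*} [MeasurableSpace Ω]

instance : Finite (ColumnSample N n) := inferInstanceAs (Finite {s : Finset (Fin N) // s.card = n})

instance : DiscreteMeasurableSpace (ColumnSample N n) := ⟨fun _ => trivial⟩

/-- Finitely many samples give finitely many values, so measurability of the step map in `x` is not
needed. -/
theorem exists_simpleFunc_eq_iterates (f : Vec N → ℝ) (α β μ ν : ℝ) {S : ℕ → Ω → ColumnSample N n}
    (hS : ∀ k, Measurable (S k)) (x₀ : Vec N) (k : ℕ) :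
    ∃ g : SimpleFunc Ω (Vec N), ∀ ω, g ω = iterates f α β μ ν (fun j => S j ω) x₀ k := by
  induction k with
  | zero => exact ⟨SimpleFunc.const Ω x₀, fun ω => rfl⟩
  | succ k ih =>
    obtain ⟨g, hg⟩ := ih
    let σ : SimpleFunc Ω (ColumnSample N n) :=
      ⟨S k, fun s => hS k (measurableSet_singleton s), Set.toFinite _⟩
    refine ⟨(σ.pair g).map fun p => sigmaStep f α β μ ν p.1 p.2, fun ω => ?_⟩
    simp [iterates, ← hg ω, σ]

theorem exists_forall_le_mul {f : Vec N → ℝ} (hf : IsNondegenerateSelfConcordant f) {α ν η : ℝ}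
    (hα : 0 < α ∧ α < 1 / 2) (β μ : ℝ) (hη : IsThreshold α ν η)
    {S : ℕ → Ω → ColumnSample N n} (hS : ∀ k, Measurable (S k)) (x₀ : Vec N) (k : ℕ) :
    ∃ C : ℝ, 0 ≤ C ∧ ∀ ω, newtonDecrement f (iterates f α β μ ν (fun j => S j ω) x₀ (k + 1))
      ≤ C * newtonDecrement f (iterates f α β μ ν (fun j => S j ω) x₀ k) := by
  obtain ⟨g, hg⟩ := exists_simpleFunc_eq_iterates f α β μ ν hS x₀ k
  obtain ⟨g', hg'⟩ := exists_simpleFunc_eq_iterates f α β μ ν hS x₀ (k + 1)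
  -- The ratio of decrements takes finitely many values; where the denominator vanishes, the next
  -- decrement vanishes too.
  obtain ⟨C, hC⟩ := ((g'.pair g).map fun p =>
    newtonDecrement f p.1 / newtonDecrement f p.2).finite_range.bddAbove
  refine ⟨max C 0, le_max_right _ _, fun ω => ?_⟩
  rcases (newtonDecrement_nonneg f (iterates f α β μ ν (fun j => S j ω) x₀ k)).eq_or_lt with h | h
  · rw [← h, mul_zero]
    exact (newtonDecrement_sigmaStep_eq_zero hf hα β μ hη _ h.symm).le
  · rw [← div_le_iff₀ h, ← hg, ← hg']
    exact (hC ⟨ω, rfl⟩).trans (le_max_left _ _)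

/-- The super-linear rate, with a deterministic geometric sequence. -/
theorem exists_rate {f : Vec N → ℝ} (hf : IsNondegenerateSelfConcordant f) {α β ν η : ℝ}
    (hα : 0 < α ∧ α < 1 / 2) (hβ : 0 < β ∧ β < 1) (μ : ℝ) (hη : IsThreshold α ν η)
    {xstar : Vec N} (hstar : ∀ z, f xstar ≤ f z)
    {S : ℕ → Ω → ColumnSample N n} (hS : ∀ k, Measurable (S k)) (x₀ : Vec N) :
    ∃ R : ℕ → ℝ, Antitone R ∧ Tendsto R atTop (𝓝 0) ∧
      ∀ ω k, newtonDecrement f (iterates f α β μ ν (fun j => S j ω) x₀ (k + 1))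
        ≤ R k * newtonDecrement f (iterates f α β μ ν (fun j => S j ω) x₀ k) := by
  obtain ⟨K, hK⟩ := exists_forall_newtonDecrement_le (n := n) hf hα hβ μ hη hstar x₀
  choose C hC0 hC using exists_forall_le_mul hf hα β μ hη hS x₀
  -- The sum makes `C k ≤ D·2⁻ᵏ` for `k < K`. The last term serves `k = K + m`, where `32λ ≤ 32η·2⁻ᵐ
  -- = 32η·2ᴷ·2⁻ᵏ`.
  set D := ∑ j ∈ Finset.range K, C j * 2 ^ j + 32 * η * 2 ^ K with hD
  have hsum : 0 ≤ ∑ j ∈ Finset.range K, C j * 2 ^ j :=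
    Finset.sum_nonneg fun j _ => mul_nonneg (hC0 j) (by positivity)
  have hη0 := hη.pos
  have hD0 : 0 ≤ D := by positivity
  refine ⟨fun k => D * (1 / 2) ^ k, fun i j hij => ?_, ?_, fun ω k => ?_⟩
  · exact mul_le_mul_of_nonneg_left
      (pow_le_pow_of_le_one (by norm_num) (by norm_num) hij) hD0
  · have h := tendsto_pow_atTop_nhds_zero_of_lt_one (r := (1 / 2 : ℝ)) (by norm_num) (by norm_num)
    simpa using h.const_mul D
  · have hl := newtonDecrement_nonneg f (iterates f α β μ ν (fun j => S j ω) x₀ k)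
    have h2 : (2 : ℝ) ^ k * (1 / 2) ^ k = 1 := by rw [← mul_pow]; norm_num
    rcases lt_or_ge k K with hk | hk
    · refine (hC k ω).trans (mul_le_mul_of_nonneg_right ?_ hl)
      have h1 : C k * 2 ^ k ≤ D := by
        have := Finset.single_le_sum (f := fun j => C j * 2 ^ j)
          (fun j _ => mul_nonneg (hC0 j) (by positivity)) (Finset.mem_range.2 hk)
        have h3 : 0 ≤ 32 * η * 2 ^ K := by positivity
        linarith
      calc C k = C k * 2 ^ k * (1 / 2) ^ k := by rw [mul_assoc, h2, mul_one]
        _ ≤ _ := mul_le_mul_of_nonneg_right h1 (by positivity)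
    · obtain ⟨m, rfl⟩ := Nat.exists_eq_add_of_le hk
      have h1 := hK (fun j => S j ω) m
      have hle := h1.trans
        (mul_le_of_le_one_right hη.pos.le (pow_le_one₀ (by norm_num) (by norm_num)))
      have h3 := hf.newtonDecrement_sigmaStep_le_of_threshold hα β μ hη (S (K + m) ω) hle
      refine h3.trans ?_
      rw [sq, ← mul_assoc]
      refine mul_le_mul_of_nonneg_right ?_ hl
      have h4 : (2 : ℝ) ^ K * (1 / 2) ^ K = 1 := by rw [← mul_pow]; norm_num
      have h5 : 0 ≤ (∑ j ∈ Finset.range K, C j * 2 ^ j) * (1 / 2) ^ (K + m) := by positivity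
      calc _ ≤ 32 * (η * (1 / 2) ^ m) := by gcongr
        _ = 32 * η * (2 ^ K * (1 / 2) ^ K) * (1 / 2) ^ m := by rw [h4]; ring
        _ = 32 * η * 2 ^ K * (1 / 2) ^ (K + m) := by rw [pow_add]; ring
        _ ≤ D * (1 / 2) ^ (K + m) := by rw [hD, add_mul]; linarith

end Random

end SIGMA

/-! ### Choice of constants, and passage from trajectories to expectations -/

theorem mainTheorem4 (α β μ ν : ℝ) (hα : 0 < α ∧ α < 1 / 2) (hβ : 0 < β ∧ β < 1)
    (hμ : 0 ≤ μ ∧ μ < 1) (hν : 0 < ν ∧ ν < 1) :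
    ∃ γ η : ℝ, 0 < γ ∧ 0 < η ∧ η < (3 - Real.sqrt 5) / 2 ∧
      ∀ (N n : ℕ), 1 ≤ n → n < N →
      ∀ (f : SIGMA.Vec N → ℝ), StrictConvexOn ℝ Set.univ f → SIGMA.IsSelfConcordant 2 f →
      ∀ (xstar : SIGMA.Vec N), (∀ y, f xstar ≤ f y) →
      ∀ (x₀ : SIGMA.Vec N) (Ω : Type*) [MeasurableSpace Ω] (Pr : Measure Ω)
        [IsProbabilityMeasure Pr] (S : ℕ → Ω → SIGMA.ColumnSample N n),
        SIGMA.IsUniformSampling Pr S →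
      ∀ (x : ℕ → Ω → SIGMA.Vec N),
        (∀ k ω, x k ω = SIGMA.iterates f α β μ ν (fun j => S j ω) x₀ k) →
        -- the iterates are random vectors and all the expectations below exist
        (∀ k, Measurable (x k) ∧ Integrable (fun ω => f (x k ω)) Pr ∧
          Integrable (fun ω => SIGMA.newtonDecrement f (x k ω)) Pr) ∧
        -- first phase, conditionally on the current iterate, and in expectation
        (∀ k, ∀ᵐ ω ∂Pr, η < SIGMA.newtonDecrement f (x k ω) →
          (Pr[fun ω' => f (x (k + 1) ω') - f (x k ω') |
            MeasurableSpace.comap (x k) inferInstance]) ω ≤ -γ) ∧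
        (∀ k, (∀ᵐ ω ∂Pr, η < SIGMA.newtonDecrement f (x k ω)) →
          ∫ ω, (f (x (k + 1) ω) - f (x k ω)) ∂Pr ≤ -γ) ∧
        -- second phase, conditionally on the current iterate, and in expectation
        (∀ k, ∀ᵐ ω ∂Pr, SIGMA.newtonDecrement f (x k ω) ≤ η → x k ω ≠ xstar →
          (Pr[fun ω' => SIGMA.newtonDecrement f (x (k + 1) ω') |
            MeasurableSpace.comap (x k) inferInstance]) ω
              < SIGMA.newtonDecrement f (x k ω)) ∧
        (∀ k, (∀ᵐ ω ∂Pr, SIGMA.newtonDecrement f (x k ω) ≤ η) →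
          ¬ (∀ᵐ ω ∂Pr, x k ω = xstar) →
          ∫ ω, SIGMA.newtonDecrement f (x (k + 1) ω) ∂Pr
            < ∫ ω, SIGMA.newtonDecrement f (x k ω) ∂Pr) ∧
        -- convergence in expectation, in probability and with probability one
        Tendsto (fun k => ∫ ω, f (x k ω) ∂Pr) atTop (𝓝 (f xstar)) ∧
        TendstoInMeasure Pr (fun k ω => f (x k ω)) atTop (fun _ => f xstar) ∧
        (∀ᵐ ω ∂Pr, Tendsto (fun k => f (x k ω)) atTop (𝓝 (f xstar))) ∧
        -- super-linear rate, almost surely and in expectation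
        (∃ R : ℕ → ℝ, Antitone R ∧ Tendsto R atTop (𝓝 0) ∧
          (∀ᵐ ω ∂Pr, ∀ k, SIGMA.newtonDecrement f (x (k + 1) ω)
            ≤ R k * SIGMA.newtonDecrement f (x k ω)) ∧
          (∀ k, ∫ ω, SIGMA.newtonDecrement f (x (k + 1) ω) ∂Pr
            ≤ R k * ∫ ω, SIGMA.newtonDecrement f (x k ω) ∂Pr)) := by
  have hη : SIGMA.IsThreshold α ν (min (min ν (1 / 2 - α)) (1 / 64)) :=
    ⟨lt_min (lt_min hν.1 (by linarith [hα.2])) (by norm_num),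
      (min_le_left _ _).trans (min_le_left _ _), (min_le_left _ _).trans (min_le_right _ _),
      min_le_right _ _⟩
  set η := min (min ν (1 / 2 - α)) (1 / 64)
  refine ⟨α * β * η ^ 2 / (1 + η), η, ?_, hη.pos, ?_, ?_⟩
  · have := hα.1; have := hβ.1; have := hη.pos
    positivity
  -- Then `(3 - √5)/2 > 1/4`, well above `1/64`.
  · have : √5 < 5 / 2 := (Real.sqrt_lt' (by norm_num)).2 (by norm_num)
    linarith [hη.le_one]
  intro N n _ _ f hconv hsc xstar hstar x₀ Ω _ Pr _ S hS x hx
  have hf := hsc.nondegenerate hconv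
  have hstep : ∀ k ω, x (k + 1) ω = SIGMA.sigmaStep f α β μ ν (S k ω) (x k ω) := fun k ω => by
    rw [hx, hx, SIGMA.iterates]
  have hlmeas : Measurable (SIGMA.newtonDecrement f) := hf.continuous_newtonDecrement.measurable
  have hsimple : ∀ k, ∃ g : SimpleFunc Ω (SIGMA.Vec N), ⇑g = x k := fun k => by
    obtain ⟨g, hg⟩ := SIGMA.exists_simpleFunc_eq_iterates f α β μ ν hS.measurable x₀ k
    exact ⟨g, funext fun ω => by rw [hg, hx]⟩
  have hmeas : ∀ k, Measurable (x k) := fun k => by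
    obtain ⟨g, hg⟩ := hsimple k
    exact hg ▸ g.measurable
  have hint : ∀ (h : SIGMA.Vec N → ℝ) k, Integrable (fun ω => h (x k ω)) Pr := fun h k => by
    obtain ⟨g, hg⟩ := hsimple k
    rw [← hg]
    exact (g.map h).integrable_of_isFiniteMeasure
  have hle : ∀ k, MeasurableSpace.comap (x k) inferInstance ≤ ‹MeasurableSpace Ω› :=
    fun k => (hmeas k).comap_le
  have hphase1 : ∀ k ω, η < SIGMA.newtonDecrement f (x k ω) →
      f (x (k + 1) ω) - f (x k ω) ≤ -(α * β * η ^ 2 / (1 + η)) := fun k ω h => by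
    have := hf.apply_sigmaStep_le_sub hα hβ μ hη.pos hη.le_nu (S k ω) h
    rw [hstep]
    linarith
  have hphase2 : ∀ k ω, SIGMA.newtonDecrement f (x k ω) ≤ η →
      SIGMA.newtonDecrement f (x (k + 1) ω) ≤ 1 / 2 * SIGMA.newtonDecrement f (x k ω) :=
    fun k ω h => by
      rw [hstep]
      exact hf.newtonDecrement_sigmaStep_le_half hα β μ hη _ h
  have hlim : ∀ ω, Tendsto (fun k => f (x k ω)) atTop (𝓝 (f xstar)) := fun ω => by
    simp only [hx]
    exact SIGMA.tendsto_apply_iterates hf hα hβ μ hη hstar x₀ _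
  refine ⟨fun k => ⟨hmeas k, hint f k, hint _ k⟩, fun k => ?_, fun k hk => ?_, fun k => ?_,
    fun k hk hne => ?_, ?_, ?_, Eventually.of_forall hlim, ?_⟩
  · exact SIGMA.condExp_le_of_le_on (hle k) ((hint f (k + 1)).sub (hint f k))
      (integrable_const _) stronglyMeasurable_const
      (A := {ω | η < SIGMA.newtonDecrement f (x k ω)})
      ⟨{z | η < SIGMA.newtonDecrement f z}, measurableSet_lt measurable_const hlmeas, rfl⟩
      (hphase1 k)
  · have := integral_mono_ae ((hint f (k + 1)).sub (hint f k)) (integrable_const _)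
      (hk.mono (hphase1 k))
    simpa using this
  · have h := SIGMA.condExp_le_of_le_on (hle k) (hint (SIGMA.newtonDecrement f) (k + 1))
      ((hint (SIGMA.newtonDecrement f) k).const_mul (1 / 2))
      ((hlmeas.comp (comap_measurable (x k))).const_mul (1 / 2)).stronglyMeasurable
      (A := {ω | SIGMA.newtonDecrement f (x k ω) ≤ η})
      ⟨{z | SIGMA.newtonDecrement f z ≤ η}, measurableSet_le hlmeas measurable_const, rfl⟩
      (hphase2 k)
    filter_upwards [h] with ω h h1 h2
    have hpos : 0 < SIGMA.newtonDecrement f (x k ω) :=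
      (SIGMA.newtonDecrement_nonneg f _).lt_of_ne fun h0 =>
        h2 (hf.eq_of_newtonDecrement_eq_zero hconv hstar h0.symm)
    have := h h1
    linarith
  · have h1 := integral_mono_ae (hint (SIGMA.newtonDecrement f) (k + 1))
      ((hint (SIGMA.newtonDecrement f) k).const_mul (1 / 2)) (hk.mono (hphase2 k))
    rw [integral_const_mul] at h1
    have hnn : 0 ≤ fun ω => SIGMA.newtonDecrement f (x k ω) := fun ω =>
      SIGMA.newtonDecrement_nonneg f _
    have hpos : 0 < ∫ ω, SIGMA.newtonDecrement f (x k ω) ∂Pr := by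
      refine (integral_nonneg hnn).lt_of_ne fun h0 => hne ?_
      filter_upwards [(integral_eq_zero_iff_of_nonneg hnn (hint _ k)).1 h0.symm] with ω hω
      exact hf.eq_of_newtonDecrement_eq_zero hconv hstar hω
    linarith
  -- Monotone descent keeps `f (x k ω)` between `f xstar` and `f x₀`, so a constant dominates.
  · have h := tendsto_integral_of_dominated_convergence (μ := Pr) (F := fun k ω => f (x k ω))
      (f := fun _ => f xstar) (fun _ => |f x₀| + |f xstar|)
      (fun k => (hint f k).aestronglyMeasurable) (integrable_const _)
      (fun k => Eventually.of_forall fun ω => by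
        have h1 := hstar (x k ω)
        have h2 : f (x k ω) ≤ f x₀ := by
          rw [hx]
          exact SIGMA.apply_iterates_le hf hα hβ μ ν _ x₀ k
        rw [Real.norm_eq_abs, abs_le]
        constructor
        · linarith [neg_abs_le (f xstar), abs_nonneg (f x₀)]
        · linarith [le_abs_self (f x₀), abs_nonneg (f xstar)])
      (Eventually.of_forall hlim)
    simpa using h
  · exact tendstoInMeasure_of_tendsto_ae (fun k => (hint f k).aestronglyMeasurable)
      (Eventually.of_forall hlim)
  · obtain ⟨R, hR, hR0, hRle⟩ := SIGMA.exists_rate hf hα hβ μ hη hstar hS.measurable x₀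
    have hRle' : ∀ ω k, SIGMA.newtonDecrement f (x (k + 1) ω)
        ≤ R k * SIGMA.newtonDecrement f (x k ω) := fun ω k => by
      simpa only [hx] using hRle ω k
    refine ⟨R, hR, hR0, Eventually.of_forall hRle', fun k => ?_⟩
    rw [← integral_const_mul]
    exact integral_mono (hint _ (k + 1)) ((hint _ k).const_mul _) fun ω => hRle' ω k
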